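/- Let $N\ge 1$, let $A$ be an arbitrary fixed complex $N\times N$ matrix, and let $G_A=G_0+A$, where $G_0$ is a complex Ginibre matrix, i.e. its entries are independent standard complex Gaussian variables $(x+iy)/\sqrt2$ with $x,y$ independent real $\mathcal N(0,1)$ variables. For a complex $N\times N$ matrix $X$ let $$\Pi_X=\int_0^{2\pi}\frac{d\theta}{2\pi}\sum_{(z,\mathbf v)\in E_\theta(X)}\delta_{(z,\mathbf v)},\qquad E_\theta(X)=\{(z,\mathbf v): X\mathbf v=z\mathbf v,\ \mathbf v^*\mathbf v=1,\ v_1=|v_1|e^{i\theta}\},$$ be the joint empirical measure on $\mathbb C\times\mathbf S_N^c$, where $\mathbf S_N^c=\{\mathbf v\in\mathbb C^N:\mathbf v^*\mathbf v=1\}$ (for $X$ with $N$ distinct eigenvalues and no eigenvector with vanishing first entry, $E_\theta(X)$ consists of exactly one pair $(z_a,\mathbf v_a(\theta))$ for each eigenvalue $z_a$). Let $\mu_H$ be the uniform (unitarily invariant) probability measure on $\mathbf S_N^c$. For $z\in\mathbb C$ and $\mathbf v\in\mathbf S_N^c$ put $A_z=A-z\mathbf 1_N$, $P_{\mathbf v}=\mathbf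 1_N-\mathbf v\mathbf v^*$ and $T_A(\mathbf v)=A_z^*P_{\mathbf v}A_zP_{\mathbf v}$. Then $X\mapsto\Pi_X$ is measurable up to a null set of the law of $G_A$, the integral $$F_A(z,\mathbf v)=\frac{1}{\pi\,\Gamma(N)}\,e^{-\mathbf v^*A_z^*A_z\mathbf v}\int_0^\infty\frac{dR}{R}\,e^{-R}\det\bigl[R\,\mathbf 1_N+T_A(\mathbf v)\bigr]$$ converges absolutely for all $(z,\mathbf v)\in\mathbb C\times\mathbf S_N^c$ and defines a real, nonnegative, measurable function of $(z,\mathbf v)$, and the mean joint empirical measure $\langle\Pi_{G_A}\rangle$ has density $F_A(z,\mathbf v)$ with respect to $d^2z\,d\mu_H(\mathbf v)$. Equivalently, the joint law $\frac1N\langle\Pi_{G_A}\rangle$ of an eigenvalue and its normalized right eigenvector has density $$\mathcal P_N^{(A)}(z,\mathbf v)=\frac1N F_A(z,\mathbf v)$$ with respect to $d^2z\,d\mu_H(\mathbf v)$. -/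

import Mathlib

open MeasureTheory ProbabilityTheory Matrix

namespace GinibreJPD

noncomputable section

/-- Matrices carry the product (Borel) σ-algebra of their entries. -/
instance matrixMeasurableSpace {N : ℕ} : MeasurableSpace (Matrix (Fin N) (Fin N) ℂ) :=
  MeasurableSpace.pi

/-- The law `N_ℂ(0,1)` of `(x + i y) / √2` with `x, y` independent standard real Gaussians. -/
def stdComplexGaussian : Measure ℂ :=
  ((gaussianReal 0 1).prod (gaussianReal 0 1)).map
    (fun p : ℝ × ℝ => ((p.1 : ℂ) + Complex.I * (p.2 : ℂ)) / ((Real.sqrt 2 : ℝ) : ℂ))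

/-- The complex Ginibre ensemble: independent entries, each with law `N_ℂ(0,1)`. -/
def ginibreLaw (N : ℕ) : Measure (Matrix (Fin N) (Fin N) ℂ) :=
  Measure.pi (fun _ : Fin N => Measure.pi (fun _ : Fin N => stdComplexGaussian))

/-- The law of `G_A = G₀ + A`, with `G₀` complex Ginibre. -/
def deformedGinibreLaw {N : ℕ} (A : Matrix (Fin N) (Fin N) ℂ) :
    Measure (Matrix (Fin N) (Fin N) ℂ) :=
  (ginibreLaw N).map (fun G => G + A)

/-- The unit sphere `{v ∈ ℂ^N : v* v = 1}`. -/
abbrev ComplexSphere (N : ℕ) : Type :=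
  Metric.sphere (0 : EuclideanSpace ℂ (Fin N)) 1

/-- The uniform probability measure `μ_H` on the complex unit sphere: the surface measure
induced by Lebesgue measure on `ℂ^N`, divided by its total mass. -/
def haarSphere (N : ℕ) : Measure (ComplexSphere N) :=
  ((volume : Measure (EuclideanSpace ℂ (Fin N))).toSphere Set.univ)⁻¹ •
    (volume : Measure (EuclideanSpace ℂ (Fin N))).toSphere

/-- The pairs `(z, v)` of an eigenvalue of `X` and a unit right eigenvector whose first entry
has phase `θ`. If `X` has `N` distinct eigenvalues and no eigenvector with vanishing first
entry, these are exactly `N` pairs, one for each eigenvalue. -/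
def eigenpairs {N : ℕ} [NeZero N] (X : Matrix (Fin N) (Fin N) ℂ) (θ : ℝ) :
    Set (ℂ × ComplexSphere N) :=
  {p | X *ᵥ p.2.1.ofLp = p.1 • p.2.1.ofLp ∧
    p.2.1 0 = (‖p.2.1 0‖ : ℂ) * Complex.exp (Complex.I * (θ : ℂ))}

/-- The empirical measure `∑ₐ δ_{(zₐ, vₐ(θ))}`, the eigenvectors having phase `θ`. -/
def empiricalAtPhase {N : ℕ} [NeZero N] (X : Matrix (Fin N) (Fin N) ℂ) (θ : ℝ) :
    Measure (ℂ × ComplexSphere N) :=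
  Measure.sum (fun p : eigenpairs X θ => Measure.dirac (p : ℂ × ComplexSphere N))

/-- The uniform distribution `dθ / 2π` on `[0, 2π)`. -/
def uniformPhase : Measure ℝ :=
  (ENNReal.ofReal (2 * Real.pi))⁻¹ • volume.restrict (Set.Ico 0 (2 * Real.pi))

/-- The joint empirical measure `Π_N` of eigenvalues and right eigenvectors of `X`,
averaged over the phase. -/
def jointEmpirical {N : ℕ} [NeZero N] (X : Matrix (Fin N) (Fin N) ℂ) :
    Measure (ℂ × ComplexSphere N) :=
  uniformPhase.bind (fun θ => empiricalAtPhase X θ)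

/-- The expectation `⟨Π_N⟩_X` of the joint empirical measure over an ensemble of matrices. -/
def meanJointEmpirical {N : ℕ} [NeZero N] (μ : Measure (Matrix (Fin N) (Fin N) ℂ)) :
    Measure (ℂ × ComplexSphere N) :=
  μ.bind jointEmpirical

/-- The joint law `(1/N) ⟨Π_N⟩_X` of an eigenvalue and its unit right eigenvector. -/
def jointLaw {N : ℕ} [NeZero N] (μ : Measure (Matrix (Fin N) (Fin N) ℂ)) :
    Measure (ℂ × ComplexSphere N) :=
  (N : ENNReal)⁻¹ • meanJointEmpirical μ

/-- The matrix `A_z = A - z 1`. -/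
def shifted {N : ℕ} (A : Matrix (Fin N) (Fin N) ℂ) (z : ℂ) : Matrix (Fin N) (Fin N) ℂ :=
  A - z • (1 : Matrix (Fin N) (Fin N) ℂ)

/-- The matrix `P_v = 1 - v v*`. -/
def proj {N : ℕ} (v : Fin N → ℂ) : Matrix (Fin N) (Fin N) ℂ :=
  1 - vecMulVec v (star v)

/-- The matrix `T_A(v) = A_z* P_v A_z P_v`. -/
def tMatrix {N : ℕ} (A : Matrix (Fin N) (Fin N) ℂ) (z : ℂ) (v : Fin N → ℂ) :
    Matrix (Fin N) (Fin N) ℂ :=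
  (shifted A z)ᴴ * proj v * shifted A z * proj v

/-- The integrand `R⁻¹ e^{-R} det (R 1 + T_A(v))`. -/
def jpdIntegrand {N : ℕ} (A : Matrix (Fin N) (Fin N) ℂ) (z : ℂ) (v : Fin N → ℂ) (R : ℝ) : ℂ :=
  ((1 / R * Real.exp (-R) : ℝ) : ℂ) *
    ((R : ℂ) • (1 : Matrix (Fin N) (Fin N) ℂ) + tMatrix A z v).det

/-- The function
`(π Γ(N))⁻¹ exp (- v* A_z* A_z v) ∫₀^∞ (dR/R) e^{-R} det (R 1 + T_A(v))`. -/
def jpdFormula {N : ℕ} (A : Matrix (Fin N) (Fin N) ℂ) (z : ℂ) (v : Fin N → ℂ) : ℂ :=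
  ((1 / (Real.pi * Real.Gamma (N : ℝ)) : ℝ) : ℂ) *
    Complex.exp (-(star v ⬝ᵥ (((shifted A z)ᴴ * shifted A z) *ᵥ v))) *
    ∫ R in Set.Ioi (0 : ℝ), jpdIntegrand A z v R

end

end GinibreJPD

/-!
Write `X = (x₁ | B)` with first column `x₁`, and let `u = (1, y)` be an eigenvector of `X` with
eigenvalue `z`, normalized by its first entry. The equation `X u = z u` determines `x₁ = z u - B y`,
so that the matrices with a marked eigenpair are parametrized by the chart `(z, y, B)`, and
forgetting the eigenpair becomes the map `eigenMap : (z, y, B) ↦ (z u - B y, B)`. Its derivative is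
block triangular, and its real Jacobian is `|det J|²` with `J = (u | z E - B)`
(`det_eigenMapRealDeriv`), where `E` consists of the last `N - 1` columns of the identity. Almost
every `X` has no eigenvector with vanishing first entry (`ae_noDegenerateEigenvector`), hence the
points of `E_θ(X)` correspond to the points of the fibre of `eigenMap` over `X`. The area formula
with multiplicities (`exists_measurable_fiber_sum`) turns the expectation of the empirical measure
into an integral over the chart, and provides the measurability of `X ↦ Π_X`.

For fixed `(z, y)` the integral over `B` is Gaussian. Let `v` be the unit vector proportional to
`u`, and choose unitary matrices `V`, `U` with first column `v` for which the compression of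
`Uᴴ (A - z) V` to the last `N - 1` coordinates is diagonal with entries `dᵢ`, by a singular value
decomposition (`exists_unitary_compression_diagonal`). In these coordinates the density of `X`
splits into `exp (-‖(A - z) v‖²)`, a free Gaussian row, and the law of a Ginibre matrix `G` of size
`N - 1` in which `|det J|²` becomes `|det (D + G)|²`. The identity
`E |det (D + G)|² = ∫₀^∞ e^{-R} ∏ᵢ (R + |dᵢ|²) dR` (`lintegral_sq_norm_det_diagonal_add`) follows by
expanding both sides into the sum of `∏ᵢ (1 + |dᵢ|² [σ i = i])` over the permutations `σ`. On the
other hand `det (R + T_A(v)) = R ∏ᵢ (R + |dᵢ|²)` (`det_smul_one_add_tMatrix`), so that the integrand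
in the formula for the density has no singularity at `0`, and the formula is the result of the
integration over `B` (`lintegral_columnsDensity_eigenMap`). Finally the uniform measure of the sphere has density
proportional to `(1 + ‖y‖²)^(-N)` in the chart `(y, θ)` (`lintegral_haarSphere`); this factor is
produced by the change of variables in `B`.
-/

namespace GinibreJPD

/-! ### The area formula for maps with several preimages -/

section AreaFormula

open Set Function

variable {E : Type*} [NormedAddCommGroup E] [NormedSpace ℝ E] [FiniteDimensional ℝ E]

/-- The noncritical points of a `C¹` map split into countably many measurable pieces on each of
which the map is injective. -/
theorem exists_partition_injOn [MeasurableSpace E] [BorelSpace E]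
    {f : E → E} {f' : E → E →L[ℝ] E} (hf : ∀ x, HasStrictFDerivAt f (f' x) x)
    (hf' : Continuous f') :
    ∃ P : ℕ → Set E, (∀ k, MeasurableSet (P k)) ∧ Pairwise (Disjoint on P) ∧
      (∀ k, InjOn f (P k)) ∧ ⋃ k, P k = {x | (f' x).det ≠ 0} := by
  have hopen : IsOpen {x | (f' x).det ≠ 0} :=
    isOpen_ne_fun (ContinuousLinearMap.continuous_det.comp hf') continuous_const
  have hloc : ∀ x, ∃ U : Set E, IsOpen U ∧ InjOn f U ∧ ((f' x).det ≠ 0 → x ∈ U) := by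
    intro x
    by_cases hx : (f' x).det ≠ 0
    · have hx' : HasStrictFDerivAt f
          (((f' x).toContinuousLinearEquivOfDetNeZero hx : E ≃L[ℝ] E) : E →L[ℝ] E) x := by
        simpa using hf x
      exact ⟨(hx'.toOpenPartialHomeomorph f).source, (hx'.toOpenPartialHomeomorph f).open_source,
        (hx'.toOpenPartialHomeomorph f).injOn, fun _ => hx'.mem_toOpenPartialHomeomorph_source⟩
    · exact ⟨∅, isOpen_empty, by simp, fun h => absurd h hx⟩
  choose U hU hinj hmem using hloc
  obtain ⟨t, -, htc, hcov⟩ := TopologicalSpace.countable_cover_nhdsWithin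
    (f := U) (s := {x | (f' x).det ≠ 0})
    fun x hx => mem_nhdsWithin_of_mem_nhds ((hU x).mem_nhds (hmem x hx))
  have hseq : ∃ V : ℕ → Set E, (∀ k, IsOpen (V k)) ∧ (∀ k, InjOn f (V k)) ∧
      {x | (f' x).det ≠ 0} ⊆ ⋃ k, V k := by
    rcases t.eq_empty_or_nonempty with rfl | hne
    · exact ⟨fun _ => ∅, fun _ => isOpen_empty, fun _ => by simp, by simpa using hcov⟩
    · obtain ⟨g, hg⟩ := htc.exists_eq_range hne
      refine ⟨fun k => U (g k), fun k => hU _, fun k => hinj _, ?_⟩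
      rw [hg, biUnion_range] at hcov
      exact hcov
  obtain ⟨V, hVo, hVi, hVc⟩ := hseq
  -- the inverse function theorem provides a countable cover; make its pieces disjoint
  refine ⟨disjointed fun k => V k ∩ {x | (f' x).det ≠ 0}, fun k => ?_, disjoint_disjointed _,
    fun k => ?_, ?_⟩
  · exact MeasurableSet.disjointed (fun i => ((hVo i).inter hopen).measurableSet) k
  · exact (hVi k).mono ((disjointed_subset _ _).trans inter_subset_left)
  · rw [iUnion_disjointed, ← iUnion_inter]
    exact inter_eq_right.2 hVc

/-- **Area formula with multiplicities**, for a measure-valued weight `m`. The fibre sum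
`x ↦ ∑_{f p = x} m p` of a `C¹` map is almost everywhere equal to a measurable
measure-valued function, and it is integrated by means of the Jacobian of `f`. -/
theorem exists_measurable_fiber_sum [MeasurableSpace E] [BorelSpace E]
    (μ : Measure E) [μ.IsAddHaarMeasure]
    {f : E → E} {f' : E → E →L[ℝ] E} (hf : ∀ x, HasStrictFDerivAt f (f' x) x)
    (hf' : Continuous f') {β : Type*} [MeasurableSpace β] {m : E → Measure β}
    (hm : Measurable m) :
    ∃ κ : E → Measure β, Measurable κ ∧
      (∀ᵐ x ∂μ, κ x = Measure.sum (fun p : f ⁻¹' {x} => m p) ∧ Countable (f ⁻¹' {x})) ∧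
      ∀ s, MeasurableSet s → ∀ w : E → ENNReal, Measurable w →
        ∫⁻ x, w x * κ x s ∂μ =
          ∫⁻ p, ENNReal.ofReal |(f' p).det| * (w (f p) * m p s) ∂μ := by
  obtain ⟨P, hPm, hPd, hPi, hPU⟩ := exists_partition_injOn hf hf'
  have hfd : ∀ k, ∀ x ∈ P k, HasFDerivWithinAt f (f' x) (P k) x :=
    fun k x _ => (hf x).hasFDerivAt.hasFDerivWithinAt
  have hemb : ∀ k, MeasurableEmbedding (fun p : P k => f p) :=
    fun k => measurableEmbedding_of_fderivWithin (hPm k) (hfd k) (hPi k)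
  set ext : ℕ → E → Measure β :=
    fun k => Function.extend (fun p : P k => f p) (fun p => m p) (fun _ => 0) with hext
  have hextm : ∀ k, Measurable (ext k) := fun k =>
    (hemb k).measurable_extend (hm.comp measurable_subtype_coe) measurable_const
  have hext_apply : ∀ k p, p ∈ P k → ext k (f p) = m p := fun k p hp =>
    (hemb k).injective.extend_apply _ _ (⟨p, hp⟩ : P k)
  have hext_zero : ∀ k x, x ∉ f '' P k → ext k x = 0 := by
    intro k x hx
    refine Function.extend_apply' _ _ _ ?_
    rintro ⟨p, rfl⟩
    exact hx ⟨p, p.2, rfl⟩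
  -- `ext k x` is `m p` for the point `p ∈ P k` over `x`, and `0` if there is none
  refine ⟨fun x => Measure.sum fun k => ext k x, ?_, ?_, ?_⟩
  · refine Measure.measurable_of_measurable_coe _ fun s hs => ?_
    simp_rw [Measure.sum_apply _ hs]
    exact Measurable.tsum fun k => (Measure.measurable_coe hs).comp (hextm k)
  · -- critical values form a null set, by Sard's theorem
    have hcrit : μ (f '' {x | (f' x).det = 0}) = 0 :=
      addHaar_image_eq_zero_of_det_fderivWithin_eq_zero μ
        (fun x _ => (hf x).hasFDerivAt.hasFDerivWithinAt) (fun x hx => hx)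
    filter_upwards [measure_eq_zero_iff_ae_notMem.1 hcrit] with x hx
    have hfib : ∀ p : f ⁻¹' {x}, ∃ k, (p : E) ∈ P k := by
      intro p
      have : (p : E) ∈ ⋃ k, P k := by
        rw [hPU]
        intro h0
        exact hx ⟨p, h0, p.2⟩
      simpa using this
    constructor
    · ext s hs
      rw [Measure.sum_apply _ hs, Measure.sum_apply _ hs]
      have h1 : ∀ k, ext k x s = ∑' p : f ⁻¹' {x}, (P k).indicator (fun q => m q s) p := by
        intro k
        by_cases hk : x ∈ f '' P k
        · obtain ⟨q, hq, rfl⟩ := hk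
          rw [tsum_eq_single (⟨q, rfl⟩ : f ⁻¹' {f q})]
          · rw [hext_apply k q hq, indicator_of_mem hq]
          · intro p hp
            refine indicator_of_notMem (fun hpk => hp ?_) _
            exact Subtype.ext (hPi k hpk hq p.2)
        · rw [hext_zero k x hk]
          symm
          rw [ENNReal.tsum_eq_zero.2]
          · simp
          · intro p
            exact indicator_of_notMem (fun hpk => hk ⟨p, hpk, p.2⟩) _
      simp_rw [h1]
      rw [ENNReal.tsum_comm]
      refine tsum_congr fun p => ?_
      obtain ⟨k, hk⟩ := hfib p
      rw [tsum_eq_single k, indicator_of_mem hk]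
      intro j hj
      exact indicator_of_notMem (fun hpj => (hPd hj).le_bot ⟨hpj, hk⟩) _
    · choose k hk using hfib
      refine Function.Injective.countable (f := k) fun p q hpq => Subtype.ext ?_
      exact hPi (k p) (hk p) (hpq ▸ hk q) (p.2.trans q.2.symm)
  · intro s hs w hw
    have hes : ∀ k, Measurable fun x => ext k x s := fun k =>
      (Measure.measurable_coe hs).comp (hextm k)
    simp_rw [Measure.sum_apply _ hs, ← ENNReal.tsum_mul_left]
    rw [lintegral_tsum (f := fun k x => w x * ext k x s) fun k => (hw.mul (hes k)).aemeasurable]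
    have h1 : ∀ k, ∫⁻ x, w x * ext k x s ∂μ =
        ∫⁻ p in P k, ENNReal.ofReal |(f' p).det| * (w (f p) * m p s) ∂μ := by
      intro k
      rw [← setLIntegral_eq_of_support_subset (s := f '' P k) ?_,
        lintegral_image_eq_lintegral_abs_det_fderiv_mul μ (hPm k) (hfd k) (hPi k)]
      · refine setLIntegral_congr_fun (hPm k) fun p hp => ?_
        simp only [hext_apply k p hp]
      · intro x hx
        by_contra hxk
        exact hx (by simp [hext_zero k x hxk])
    simp_rw [h1]
    -- the critical points missing from the partition have vanishing Jacobian
    rw [← lintegral_iUnion hPm hPd, hPU]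
    refine setLIntegral_eq_of_support_subset fun p hp => ?_
    intro h0
    exact hp (by simp [h0])

end AreaFormula

/-! ### Second moments of complex Gaussian vectors -/

section Moments

open ComplexConjugate

theorem measurable_stdComplexGaussian_map :
    Measurable (fun p : ℝ × ℝ =>
      ((p.1 : ℂ) + Complex.I * (p.2 : ℂ)) / ((Real.sqrt 2 : ℝ) : ℂ)) := by
  fun_prop

instance isProbabilityMeasure_stdComplexGaussian :
    IsProbabilityMeasure stdComplexGaussian :=
  Measure.isProbabilityMeasure_map measurable_stdComplexGaussian_map.aemeasurable

theorem memLp_id_stdComplexGaussian : MemLp (fun z : ℂ => z) 2 stdComplexGaussian := by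
  have h : MemLp (fun x : ℝ => (x : ℂ)) 2 (gaussianReal 0 1) :=
    (memLp_id_gaussianReal (μ := 0) (v := 1) 2).ofReal
  rw [stdComplexGaussian, memLp_map_measure_iff (by fun_prop)
    measurable_stdComplexGaussian_map.aemeasurable]
  have := ((h.comp_fst (gaussianReal 0 1)).add
    ((h.comp_snd (gaussianReal 0 1)).const_mul Complex.I)).mul_const (((Real.sqrt 2 : ℝ) : ℂ)⁻¹)
  simpa [Function.comp_def, div_eq_mul_inv] using this

theorem integral_id_stdComplexGaussian : ∫ z, z ∂stdComplexGaussian = 0 := by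
  have h : Integrable (fun x : ℝ => (x : ℂ)) (gaussianReal 0 1) :=
    ((memLp_id_gaussianReal (μ := 0) (v := 1) 1).integrable (by simp)).ofReal
  have h0 : ∫ x : ℝ, (x : ℂ) ∂gaussianReal 0 1 = 0 := by
    rw [integral_complex_ofReal, integral_id_gaussianReal, Complex.ofReal_zero]
  rw [stdComplexGaussian, integral_map measurable_stdComplexGaussian_map.aemeasurable
    (by fun_prop), integral_div, integral_add (h.comp_fst (gaussianReal 0 1))
    ((h.comp_snd (gaussianReal 0 1)).const_mul Complex.I), integral_const_mul,
    integral_fun_fst (fun x : ℝ => (x : ℂ)), integral_fun_snd (fun x : ℝ => (x : ℂ)), h0]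
  simp

theorem integral_mul_conj_stdComplexGaussian :
    ∫ z, z * conj z ∂stdComplexGaussian = 1 := by
  have h : Integrable (fun x : ℝ => x ^ 2) (gaussianReal 0 1) :=
    (memLp_id_gaussianReal (μ := 0) (v := 1) 2).integrable_sq
  have h0 : ∫ x : ℝ, x ^ 2 ∂gaussianReal 0 1 = 1 := by
    have := variance_fun_id_gaussianReal (μ := 0) (v := 1)
    rw [variance_of_integral_eq_zero (by fun_prop) integral_id_gaussianReal] at this
    simpa using this
  have hs : ((Real.sqrt 2 : ℝ) : ℂ) ^ 2 = 2 := by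
    rw [← Complex.ofReal_pow, Real.sq_sqrt (by norm_num)]
    simp
  rw [stdComplexGaussian, integral_map measurable_stdComplexGaussian_map.aemeasurable
    (by fun_prop)]
  have : ∀ p : ℝ × ℝ, ((p.1 : ℂ) + Complex.I * (p.2 : ℂ)) / ((Real.sqrt 2 : ℝ) : ℂ) *
      conj (((p.1 : ℂ) + Complex.I * (p.2 : ℂ)) / ((Real.sqrt 2 : ℝ) : ℂ)) =
      (((p.1 ^ 2 + p.2 ^ 2) / 2 : ℝ) : ℂ) := by
    intro p
    simp only [map_div₀, map_add, map_mul, Complex.conj_ofReal, Complex.conj_I]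
    rw [div_mul_div_comm, ← sq, hs]
    push_cast
    linear_combination (-(p.2 : ℂ) ^ 2 / 2) * Complex.I_sq
  simp_rw [this]
  rw [integral_complex_ofReal, integral_div, integral_add (h.comp_fst (gaussianReal 0 1))
    (h.comp_snd (gaussianReal 0 1)), integral_fun_fst (fun x : ℝ => x ^ 2),
    integral_fun_snd (fun x : ℝ => x ^ 2), h0]
  simp

variable {ι : Type*} [Fintype ι]

theorem memLp_add_eval (a : ℂ) (j : ι) :
    MemLp (fun g : ι → ℂ => a + g j) 2 (Measure.pi fun _ => stdComplexGaussian) :=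
  (memLp_const a).add
    (memLp_id_stdComplexGaussian.comp_measurePreserving
      (measurePreserving_eval (fun _ : ι => stdComplexGaussian) j))

theorem integrable_add_eval_mul_conj (a b : ℂ) (j k : ι) :
    Integrable (fun g : ι → ℂ => (a + g j) * conj (b + g k))
      (Measure.pi fun _ => stdComplexGaussian) :=
  (memLp_add_eval a j).integrable_mul (memLp_add_eval b k).star

theorem integral_add_eval_mul_conj [DecidableEq ι] (a b : ℂ) (j k : ι) :
    ∫ g : ι → ℂ, (a + g j) * conj (b + g k) ∂(Measure.pi fun _ => stdComplexGaussian) =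
      a * conj b + if j = k then 1 else 0 := by
  have hL (j : ι) : MemLp (fun g : ι → ℂ => g j) 2 (Measure.pi fun _ => stdComplexGaussian) := by
    simpa using memLp_add_eval 0 j
  have hI (j : ι) : Integrable (fun g : ι → ℂ => g j)
      (Measure.pi fun _ => stdComplexGaussian) := (hL j).integrable (by norm_num)
  have hIc (j : ι) : Integrable (fun g : ι → ℂ => conj (g j))
      (Measure.pi fun _ => stdComplexGaussian) := (hL j).star.integrable (by norm_num)
  have hII (j k : ι) : Integrable (fun g : ι → ℂ => g j * conj (g k))
      (Measure.pi fun _ => stdComplexGaussian) := (hL j).integrable_mul (hL k).star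
  have h0 (j : ι) : ∫ g : ι → ℂ, g j ∂(Measure.pi fun _ => stdComplexGaussian) = 0 := by
    exact (integral_comp_eval (μ := fun _ : ι => stdComplexGaussian) (i := j)
      (f := fun z : ℂ => z) aestronglyMeasurable_id).trans integral_id_stdComplexGaussian
  have h0c (j : ι) : ∫ g : ι → ℂ, conj (g j) ∂(Measure.pi fun _ => stdComplexGaussian) = 0 := by
    rw [integral_conj, h0, map_zero]
  have h2 : ∫ g : ι → ℂ, g j * conj (g k) ∂(Measure.pi fun _ => stdComplexGaussian) =
      if j = k then 1 else 0 := by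
    split_ifs with hjk
    · subst hjk
      exact (integral_comp_eval (μ := fun _ : ι => stdComplexGaussian) (i := j)
        (f := fun z : ℂ => z * conj z) (by fun_prop)).trans integral_mul_conj_stdComplexGaussian
    · have hind : IndepFun (fun g : ι → ℂ => g j) (fun g : ι → ℂ => conj (g k))
          (Measure.pi fun _ => stdComplexGaussian) :=
        ((iIndepFun_pi (X := fun (_ : ι) (z : ℂ) => z)
          (μ := fun _ : ι => stdComplexGaussian) fun _ => aemeasurable_id).indepFun hjk).comp
          (φ := id) (ψ := fun z : ℂ => conj z) measurable_id (by fun_prop)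
      rw [hind.integral_fun_mul_eq_mul_integral (hI j).1 (hIc k).1, h0, zero_mul]
  have hexp : ∀ g : ι → ℂ, (a + g j) * conj (b + g k) =
      (a * conj b + conj b * g j) + (a * conj (g k) + g j * conj (g k)) := by
    intro g
    rw [map_add]
    ring
  simp_rw [hexp]
  rw [integral_add, integral_add, integral_add, integral_const_mul, integral_const_mul,
    integral_const_mul, h0, h0c, h2]
  · simp
  · exact (hIc k).const_mul _
  · exact hII j k
  · exact integrable_const _
  · exact (hI j).const_mul _
  · exact (integrable_const _).add ((hI j).const_mul _)
  · exact ((hIc k).const_mul _).add (hII j k)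

end Moments

/-! ### The mean square modulus of the determinant of a shifted Ginibre matrix -/

section Determinant

open ComplexConjugate

theorem det_mul_conj_det_eq_sum {n : ℕ} (M : Matrix (Fin n) (Fin n) ℂ) :
    M.det * conj M.det = ∑ σ : Equiv.Perm (Fin n), ∑ τ : Equiv.Perm (Fin n),
      (((Equiv.Perm.sign σ : ℤ) : ℂ) * ((Equiv.Perm.sign τ : ℤ) : ℂ)) *
        ∏ i, (M i (σ i) * conj (M i (τ i))) := by
  have h : M.det = ∑ σ : Equiv.Perm (Fin n), ((Equiv.Perm.sign σ : ℤ) : ℂ) * ∏ i, M i (σ i) := by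
    rw [← det_transpose, det_apply']
    rfl
  rw [h, map_sum, Finset.sum_mul_sum]
  refine Finset.sum_congr rfl fun σ _ => Finset.sum_congr rfl fun τ _ => ?_
  rw [map_mul, map_prod, Finset.prod_mul_distrib, map_intCast]
  ring

theorem integrable_prod_rows {n : ℕ} (K : Matrix (Fin n) (Fin n) ℂ)
    (σ τ : Equiv.Perm (Fin n)) :
    Integrable (fun G : Fin n → Fin n → ℂ =>
      ∏ i, ((K i (σ i) + G i (σ i)) * conj (K i (τ i) + G i (τ i))))
      (Measure.pi fun _ : Fin n => Measure.pi fun _ : Fin n => stdComplexGaussian) :=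
  Integrable.fintype_prod (fun i => integrable_add_eval_mul_conj (K i (σ i)) (K i (τ i)) _ _)

theorem integral_prod_rows {n : ℕ} (K : Matrix (Fin n) (Fin n) ℂ)
    (σ τ : Equiv.Perm (Fin n)) :
    ∫ G : Fin n → Fin n → ℂ, ∏ i, ((K i (σ i) + G i (σ i)) * conj (K i (τ i) + G i (τ i)))
      ∂(Measure.pi fun _ : Fin n => Measure.pi fun _ : Fin n => stdComplexGaussian) =
    ∏ i, (K i (σ i) * conj (K i (τ i)) + if σ i = τ i then 1 else 0) := by
  rw [integral_fintype_prod_eq_prod (fun i (g : Fin n → ℂ) =>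
    (K i (σ i) + g (σ i)) * conj (K i (τ i) + g (τ i)))]
  exact Finset.prod_congr rfl fun i _ => integral_add_eval_mul_conj _ _ _ _

theorem integrable_det_mul_conj {n : ℕ} (K : Matrix (Fin n) (Fin n) ℂ) :
    Integrable (fun G : Matrix (Fin n) (Fin n) ℂ => (K + G).det * conj (K + G).det)
      (ginibreLaw n) := by
  simp_rw [det_mul_conj_det_eq_sum]
  exact integrable_finsetSum _ fun σ _ => integrable_finsetSum _ fun τ _ =>
    (integrable_prod_rows K σ τ).const_mul _

/-- For a diagonal shift, the only pairs of permutations contributing to the second moment of the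
determinant are the diagonal ones. -/
theorem integral_det_mul_conj_diagonal {n : ℕ} (d : Fin n → ℂ) :
    ∫ G : Matrix (Fin n) (Fin n) ℂ, (diagonal d + G).det * conj (diagonal d + G).det
      ∂(ginibreLaw n) =
    ∑ σ : Equiv.Perm (Fin n), ∏ i, (1 + if σ i = i then d i * conj (d i) else 0) := by
  simp_rw [det_mul_conj_det_eq_sum]
  have hint (σ τ : Equiv.Perm (Fin n)) : Integrable (fun G : Matrix (Fin n) (Fin n) ℂ =>
      (((Equiv.Perm.sign σ : ℤ) : ℂ) * ((Equiv.Perm.sign τ : ℤ) : ℂ)) *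
        ∏ i, ((diagonal d + G) i (σ i) * conj ((diagonal d + G) i (τ i)))) (ginibreLaw n) :=
    (integrable_prod_rows (diagonal d) σ τ).const_mul _
  rw [integral_finsetSum _ fun σ _ => integrable_finsetSum _ fun τ _ => hint σ τ]
  refine Finset.sum_congr rfl fun σ _ => ?_
  rw [integral_finsetSum _ fun τ _ => hint σ τ]
  have hval (τ : Equiv.Perm (Fin n)) : ∫ G : Matrix (Fin n) (Fin n) ℂ,
      (((Equiv.Perm.sign σ : ℤ) : ℂ) * ((Equiv.Perm.sign τ : ℤ) : ℂ)) *
        ∏ i, ((diagonal d + G) i (σ i) * conj ((diagonal d + G) i (τ i))) ∂(ginibreLaw n) =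
      (((Equiv.Perm.sign σ : ℤ) : ℂ) * ((Equiv.Perm.sign τ : ℤ) : ℂ)) *
        ∏ i, (diagonal d i (σ i) * conj (diagonal d i (τ i)) + if σ i = τ i then 1 else 0) := by
    rw [integral_const_mul]
    exact congrArg _ (integral_prod_rows (diagonal d) σ τ)
  simp_rw [hval]
  rw [Finset.sum_eq_single σ]
  · have hs : ((Equiv.Perm.sign σ : ℤ) : ℂ) * ((Equiv.Perm.sign σ : ℤ) : ℂ) = 1 := by
      rw [← Int.cast_mul, ← Units.val_mul, Int.units_mul_self]
      simp
    rw [hs, one_mul]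
    refine Finset.prod_congr rfl fun i _ => ?_
    rcases eq_or_ne (σ i) i with h | h
    · simp [h, add_comm]
    · simp [h, h.symm]
  · intro τ _ hne
    obtain ⟨i, hi⟩ : ∃ i, τ i ≠ σ i := by
      by_contra! h
      exact hne (Equiv.ext h)
    refine mul_eq_zero_of_right _ (Finset.prod_eq_zero (Finset.mem_univ i) ?_)
    rw [if_neg hi.symm, add_zero, mul_eq_zero]
    by_cases h : i = σ i
    · right
      rw [diagonal_apply_ne _ (fun h' => hi (h'.symm.trans h)), map_zero]
    · left
      exact diagonal_apply_ne _ h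
  · simp

/-- Expanding the product, the subset of indices contributing `1` being `S`: exactly `|S|!`
permutations fix all points outside of `S`. -/
theorem sum_perm_prod_one_add_fixed {n : ℕ} (c : Fin n → ℝ) :
    ∑ σ : Equiv.Perm (Fin n), ∏ i, (1 + if σ i = i then c i else 0) =
      ∑ S ∈ (Finset.univ : Finset (Fin n)).powerset,
        (S.card.factorial : ℝ) * ∏ i ∈ Finset.univ \ S, c i := by
  simp_rw [Finset.prod_add, Finset.prod_const_one, one_mul, Finset.prod_ite_zero]
  rw [Finset.sum_comm]
  refine Finset.sum_congr rfl fun S _ => ?_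
  refine (Finset.sum_congr rfl fun σ _ => (?_ : _ =
    (if ∀ i ∈ Finset.univ \ S, σ i = i then 1 else 0) * ∏ i ∈ Finset.univ \ S, c i)).trans ?_
  · split_ifs <;> simp
  rw [← Finset.sum_mul, Finset.sum_boole]
  congr 2
  rw [← Fintype.card_subtype, ← Fintype.card_coe S, ← Fintype.card_perm]
  refine (Fintype.card_congr ?_).symm
  refine (Equiv.Perm.subtypeEquivSubtypePerm (fun i => i ∈ S)).trans
    (Equiv.subtypeEquivRight fun σ => ?_)
  simp

theorem integrableOn_exp_neg_mul_pow (k : ℕ) :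
    IntegrableOn (fun R : ℝ => Real.exp (-R) * R ^ k) (Set.Ioi 0) := by
  have := Real.GammaIntegral_convergent (s := k + 1) (by positivity)
  simpa using this

theorem integral_exp_neg_mul_pow (k : ℕ) :
    ∫ R in Set.Ioi (0 : ℝ), Real.exp (-R) * R ^ k = k.factorial := by
  rw [← Real.Gamma_nat_eq_factorial, Real.Gamma_eq_integral (by positivity)]
  simp

theorem exp_neg_mul_prod_add {n : ℕ} (c : Fin n → ℝ) (R : ℝ) :
    Real.exp (-R) * ∏ i, (R + c i) = ∑ S ∈ (Finset.univ : Finset (Fin n)).powerset,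
      (Real.exp (-R) * R ^ S.card) * ∏ i ∈ Finset.univ \ S, c i := by
  simp_rw [Finset.prod_add, Finset.prod_const, Finset.mul_sum, mul_assoc]

theorem integrableOn_exp_neg_mul_prod {n : ℕ} (c : Fin n → ℝ) :
    IntegrableOn (fun R : ℝ => Real.exp (-R) * ∏ i, (R + c i)) (Set.Ioi 0) := by
  simp_rw [exp_neg_mul_prod_add]
  exact integrable_finsetSum _ fun S _ => (integrableOn_exp_neg_mul_pow _).mul_const _

theorem integral_exp_neg_mul_prod {n : ℕ} (c : Fin n → ℝ) :
    ∫ R in Set.Ioi (0 : ℝ), Real.exp (-R) * ∏ i, (R + c i) =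
      ∑ σ : Equiv.Perm (Fin n), ∏ i, (1 + if σ i = i then c i else 0) := by
  simp_rw [exp_neg_mul_prod_add]
  rw [integral_finsetSum _ fun S _ => (integrableOn_exp_neg_mul_pow _).mul_const _,
    sum_perm_prod_one_add_fixed]
  simp_rw [integral_mul_const, integral_exp_neg_mul_pow]

/-- `E |det (D + G)|² = ∫₀^∞ e^{-R} ∏ᵢ (R + |dᵢ|²) dR` for a Ginibre matrix `G` and a diagonal
matrix `D`: both sides are the sum of `∏ᵢ (1 + |dᵢ|² [σ i = i])` over the permutations `σ`. -/
theorem lintegral_sq_norm_det_diagonal_add {n : ℕ} (d : Fin n → ℂ) :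
    ∫⁻ G : Matrix (Fin n) (Fin n) ℂ, ENNReal.ofReal (‖(diagonal d + G).det‖ ^ 2)
      ∂(ginibreLaw n) =
    ENNReal.ofReal (∫ R in Set.Ioi (0 : ℝ), Real.exp (-R) * ∏ i, (R + ‖d i‖ ^ 2)) := by
  have h (G : Matrix (Fin n) (Fin n) ℂ) : (diagonal d + G).det * conj (diagonal d + G).det =
      ((‖(diagonal d + G).det‖ ^ 2 : ℝ) : ℂ) := by
    rw [Complex.mul_conj, Complex.normSq_eq_norm_sq]
  have hi : Integrable (fun G : Matrix (Fin n) (Fin n) ℂ => ‖(diagonal d + G).det‖ ^ 2)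
      (ginibreLaw n) := by
    have := (integrable_det_mul_conj (diagonal d)).re
    simp_rw [h] at this
    exact this
  rw [← ofReal_integral_eq_lintegral_ofReal hi (Filter.Eventually.of_forall fun _ => by positivity)]
  congr 1
  rw [integral_exp_neg_mul_prod, ← Complex.ofReal_inj, ← integral_complex_ofReal]
  simp_rw [← h]
  rw [integral_det_mul_conj_diagonal]
  push_cast
  refine Finset.sum_congr rfl fun σ _ => Finset.prod_congr rfl fun i _ => ?_
  split_ifs
  · rw [Complex.mul_conj, Complex.normSq_eq_norm_sq, Complex.ofReal_pow]
  · simp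

end Determinant

/-! ### Singular value decomposition on the orthogonal complement of a vector -/

section LinearAlgebra

open scoped InnerProductSpace

/-- Singular value decomposition of an endomorphism of a finite-dimensional inner product space. -/
theorem exists_orthonormalBasis_apply_eq_smul {F : Type*} [NormedAddCommGroup F]
    [InnerProductSpace ℂ F] [FiniteDimensional ℂ F] {n : ℕ} (hn : Module.finrank ℂ F = n)
    (T : F →ₗ[ℂ] F) :
    ∃ (w u : OrthonormalBasis (Fin n) ℂ F) (d : Fin n → ℂ), ∀ j, T (w j) = d j • u j := by
  have hT : (T.adjoint ∘ₗ T).IsSymmetric := by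
    intro x y
    simp [LinearMap.adjoint_inner_left, LinearMap.adjoint_inner_right]
  set w := hT.eigenvectorBasis hn with hw
  have hinner (i j : Fin n) (hij : i ≠ j) : ⟪T (w i), T (w j)⟫_ℂ = 0 := by
    rw [← LinearMap.adjoint_inner_right]
    have : T.adjoint (T (w j)) = ((hT.eigenvalues hn j : ℝ) : ℂ) • w j :=
      hT.apply_eigenvectorBasis hn j
    rw [this, inner_smul_right, w.orthonormal.2 hij, mul_zero]
  have horth : Orthonormal ℂ (Set.domRestrict {j | T (w j) ≠ 0}
      fun j => ((‖T (w j)‖⁻¹ : ℝ) : ℂ) • T (w j)) := by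
    constructor
    · rintro ⟨j, hj⟩
      have : ‖T (w j)‖ ≠ 0 := norm_ne_zero_iff.2 hj
      simp [norm_smul, this]
    · rintro ⟨i, hi⟩ ⟨j, hj⟩ hij
      have : i ≠ j := fun h => hij (Subtype.ext h)
      simp [inner_smul_left, inner_smul_right, hinner i j this]
  -- the normalized images of the eigenvectors with nonzero eigenvalue are orthonormal
  obtain ⟨u, hu⟩ := horth.exists_orthonormalBasis_extension_of_card_eq (by simp [hn])
  refine ⟨w, u, fun j => ((‖T (w j)‖ : ℝ) : ℂ), fun j => ?_⟩
  by_cases hj : T (w j) = 0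
  · simp [hj]
  · rw [hu j hj, smul_smul, ← Complex.ofReal_mul,
      mul_inv_cancel₀ (norm_ne_zero_iff.2 hj), Complex.ofReal_one, one_smul]

/-- The matrix whose first column is `v` and whose other columns are `w j`. -/
def frame {n : ℕ} (v : EuclideanSpace ℂ (Fin (n + 1)))
    (w : Fin n → EuclideanSpace ℂ (Fin (n + 1))) : Matrix (Fin (n + 1)) (Fin (n + 1)) ℂ :=
  of fun i j => (Fin.cons v w : Fin (n + 1) → EuclideanSpace ℂ (Fin (n + 1))) j i

theorem conjTranspose_frame_mul_frame {n : ℕ} {v : EuclideanSpace ℂ (Fin (n + 1))}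
    {w : Fin n → EuclideanSpace ℂ (Fin (n + 1))} (hv : ‖v‖ = 1) (hw : Orthonormal ℂ w)
    (hvw : ∀ j, ⟪v, w j⟫_ℂ = 0) : (frame v w)ᴴ * frame v w = 1 := by
  have horth : Orthonormal ℂ (Fin.cons v w : Fin (n + 1) → EuclideanSpace ℂ (Fin (n + 1))) := by
    rw [orthonormal_iff_ite]
    intro i j
    induction i using Fin.cases with
    | zero =>
      induction j using Fin.cases with
      | zero => simp [inner_self_eq_norm_sq_to_K, hv]
      | succ j => simp [hvw, (Fin.succ_ne_zero j).symm]
    | succ i =>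
      induction j using Fin.cases with
      | zero => simp [← inner_conj_symm (w i) v, hvw]
      | succ j => simpa using orthonormal_iff_ite.1 hw i j
  ext i j
  rw [one_apply, ← orthonormal_iff_ite.1 horth i j]
  simp [frame, mul_apply, PiLp.inner_apply, mul_comm]

/-- There are two unitary matrices with first column a given unit vector `v` which bring the
compression of `A` to the orthogonal complement of `v` to diagonal form. -/
theorem exists_unitary_compression_diagonal {n : ℕ} (A : Matrix (Fin (n + 1)) (Fin (n + 1)) ℂ)
    (v : EuclideanSpace ℂ (Fin (n + 1))) (hv : ‖v‖ = 1) :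
    ∃ (V U : Matrix (Fin (n + 1)) (Fin (n + 1)) ℂ) (d : Fin n → ℂ),
      Vᴴ * V = 1 ∧ Uᴴ * U = 1 ∧ (∀ i, V i 0 = v i) ∧ (∀ i, U i 0 = v i) ∧
      (Uᴴ * A * V).submatrix Fin.succ Fin.succ = diagonal d := by
  have hv0 : v ≠ 0 := by
    rintro rfl
    simp at hv
  have hrank : Module.finrank ℂ (ℂ ∙ v)ᗮ = n := by
    have : Fact (Module.finrank ℂ (EuclideanSpace ℂ (Fin (n + 1))) = n + 1) := ⟨by simp⟩
    exact Submodule.finrank_orthogonal_span_singleton hv0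
  obtain ⟨w, u, d, hd⟩ := exists_orthonormalBasis_apply_eq_smul hrank
    ((ℂ ∙ v)ᗮ.orthogonalProjectionOnto.toLinearMap ∘ₗ toEuclideanLin A ∘ₗ (ℂ ∙ v)ᗮ.subtype)
  have hperp (x : (ℂ ∙ v)ᗮ) : ⟪v, (x : EuclideanSpace ℂ (Fin (n + 1)))⟫_ℂ = 0 :=
    Submodule.mem_orthogonal_singleton_iff_inner_right.1 x.2
  have hcoe (b : OrthonormalBasis (Fin n) ℂ (ℂ ∙ v)ᗮ) :
      Orthonormal ℂ fun j => (b j : EuclideanSpace ℂ (Fin (n + 1))) :=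
    b.orthonormal.comp_linearIsometry (ℂ ∙ v)ᗮ.subtypeₗᵢ
  refine ⟨frame v fun j => w j, frame v fun j => u j, d,
    conjTranspose_frame_mul_frame hv (hcoe w) fun j => hperp _,
    conjTranspose_frame_mul_frame hv (hcoe u) fun j => hperp _, fun i => rfl, fun i => rfl, ?_⟩
  ext i j
  have h1 : ((frame v fun j => (u j : EuclideanSpace ℂ (Fin (n + 1))))ᴴ * A *
      frame v fun j => (w j : EuclideanSpace ℂ (Fin (n + 1)))) i.succ j.succ =
      ⟪(u i : EuclideanSpace ℂ (Fin (n + 1))), toEuclideanLin A (w j)⟫_ℂ := by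
    rw [Matrix.mul_assoc]
    simp [frame, mul_apply, PiLp.inner_apply, mulVec, dotProduct, mul_comm]
  have h2 : ⟪(u i : EuclideanSpace ℂ (Fin (n + 1))), toEuclideanLin A (w j)⟫_ℂ =
      ⟪u i, d j • u j⟫_ℂ := by
    rw [← hd j, Submodule.coe_inner]
    exact (Submodule.inner_orthogonalProjectionOnto_eq_of_mem_left (u i) _).symm
  rw [submatrix_apply, h1, h2, inner_smul_right, orthonormal_iff_ite.1 u.orthonormal i j,
    diagonal_apply]
  split_ifs with h
  · simp [h]
  · simp

theorem proj_eq_mul_diagonal_mul {n : ℕ} {V : Matrix (Fin (n + 1)) (Fin (n + 1)) ℂ}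
    (hV : Vᴴ * V = 1) {v : Fin (n + 1) → ℂ} (h0 : ∀ i, V i 0 = v i) :
    proj v = V * diagonal (Fin.cons 0 fun _ => 1) * Vᴴ := by
  have hV' : V * Vᴴ = 1 := mul_eq_one_comm.1 hV
  ext i j
  rw [proj, ← hV', Matrix.sub_apply, mul_apply, mul_apply, Fin.sum_univ_succ, Fin.sum_univ_succ]
  simp [vecMulVec_apply, h0]

theorem norm_det_eq_one {ι : Type*} [Fintype ι] [DecidableEq ι] {V : Matrix ι ι ℂ}
    (hV : Vᴴ * V = 1) : ‖V.det‖ = 1 := by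
  have h := congrArg (fun M : Matrix ι ι ℂ => ‖M.det‖) hV
  simp only [det_mul, det_conjTranspose, norm_mul, norm_star, det_one, norm_one] at h
  nlinarith [norm_nonneg V.det]

/-- Complementary minors of a unitary matrix have the same modulus; this is the case of the
corner entry. -/
theorem norm_det_submatrix_succ {n : ℕ} {V : Matrix (Fin (n + 1)) (Fin (n + 1)) ℂ}
    (hV : Vᴴ * V = 1) : ‖(Vᴴ.submatrix Fin.succ Fin.succ).det‖ = ‖V 0 0‖ := by
  have h1 : Vᴴ.adjugate = Vᴴ.det • V := by
    calc Vᴴ.adjugate = Vᴴ.adjugate * (Vᴴ * V) := by rw [hV, Matrix.mul_one]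
      _ = Vᴴ.det • V := by rw [← Matrix.mul_assoc, adjugate_mul, smul_mul, Matrix.one_mul]
  have h2 := congrFun (congrFun h1 0) 0
  rw [adjugate_fin_succ_eq_det_submatrix, Matrix.smul_apply] at h2
  simpa [norm_det_eq_one hV] using congrArg norm h2

/-- Expansion along a first column which vanishes below its first entry. -/
theorem det_of_column_zero {n : ℕ} (M : Matrix (Fin (n + 1)) (Fin (n + 1)) ℂ)
    (h : ∀ i : Fin n, M i.succ 0 = 0) :
    M.det = M 0 0 * (M.submatrix Fin.succ Fin.succ).det := by
  rw [det_succ_column_zero, Fin.sum_univ_succ]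
  simp [h]

/-- `det (R + T_A(v))` in terms of the singular values of the compression of `A - z` to the
orthogonal complement of `v`. -/
theorem det_smul_one_add_tMatrix {n : ℕ} {A : Matrix (Fin (n + 1)) (Fin (n + 1)) ℂ} {z : ℂ}
    {v : Fin (n + 1) → ℂ} {V U : Matrix (Fin (n + 1)) (Fin (n + 1)) ℂ} {d : Fin n → ℂ}
    (hV : Vᴴ * V = 1) (hU : Uᴴ * U = 1) (hV0 : ∀ i, V i 0 = v i) (hU0 : ∀ i, U i 0 = v i)
    (hd : (Uᴴ * shifted A z * V).submatrix Fin.succ Fin.succ = diagonal d) (R : ℝ) :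
    ((R : ℂ) • (1 : Matrix (Fin (n + 1)) (Fin (n + 1)) ℂ) + tMatrix A z v).det =
      ((R * ∏ i, (R + ‖d i‖ ^ 2) : ℝ) : ℂ) := by
  set Q := Uᴴ * shifted A z * V with hQ
  set J : Matrix (Fin (n + 1)) (Fin (n + 1)) ℂ := diagonal (Fin.cons 0 fun _ => 1) with hJ
  have hV' : V * Vᴴ = 1 := mul_eq_one_comm.1 hV
  have hQH : Qᴴ = Vᴴ * (shifted A z)ᴴ * U := by
    simp [hQ, conjTranspose_mul, Matrix.mul_assoc]
  have hconj : (R : ℂ) • (1 : Matrix (Fin (n + 1)) (Fin (n + 1)) ℂ) + tMatrix A z v =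
      V * ((R : ℂ) • 1 + Qᴴ * J * Q * J) * Vᴴ := by
    have : V * (Qᴴ * J * Q * J) * Vᴴ = tMatrix A z v := by
      rw [tMatrix]
      nth_rewrite 1 [proj_eq_mul_diagonal_mul hU hU0]
      rw [proj_eq_mul_diagonal_mul hV hV0, hQH, hQ]
      calc V * (Vᴴ * (shifted A z)ᴴ * U * J * (Uᴴ * shifted A z * V) * J) * Vᴴ
          = (V * Vᴴ) * (shifted A z)ᴴ * (U * J * Uᴴ) * shifted A z * (V * J * Vᴴ) := by
            simp only [Matrix.mul_assoc]
        _ = _ := by rw [hV', Matrix.one_mul]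
    rw [Matrix.mul_add, Matrix.add_mul, this, Matrix.mul_smul, Matrix.mul_one, Matrix.smul_mul, hV']
  have hdet : V.det * Vᴴ.det = 1 := by rw [← det_mul, hV', det_one]
  have hentry (i j : Fin (n + 1)) : (Qᴴ * J * Q * J) i j =
      (∑ k : Fin n, star (Q k.succ i) * Q k.succ j) *
        (Fin.cons 0 fun _ => 1 : Fin (n + 1) → ℂ) j := by
    rw [hJ, mul_diagonal, mul_apply, Fin.sum_univ_succ]
    simp [mul_diagonal]
  have hcol (i : Fin (n + 1)) : (Qᴴ * J * Q * J) i 0 = 0 := by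
    rw [hentry, Fin.cons_zero, mul_zero]
  have hQs (k j : Fin n) : Q k.succ j.succ = diagonal d k j := congrFun (congrFun hd k) j
  have hsub : ((R : ℂ) • (1 : Matrix (Fin (n + 1)) (Fin (n + 1)) ℂ) +
      Qᴴ * J * Q * J).submatrix Fin.succ Fin.succ =
      diagonal fun i => ((R + ‖d i‖ ^ 2 : ℝ) : ℂ) := by
    ext i j
    rw [submatrix_apply, Matrix.add_apply, hentry, Fin.cons_succ, mul_one]
    simp_rw [hQs]
    rcases eq_or_ne i j with rfl | hij
    · rw [Finset.sum_eq_single i]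
      · simp [Complex.conj_mul']
      · intro k _ hk
        simp [diagonal_apply_ne _ hk]
      · simp
    · rw [Finset.sum_eq_zero]
      · simp [hij]
      · intro k _
        by_cases hk : k = i
        · subst hk
          simp [diagonal_apply_ne _ hij]
        · simp [diagonal_apply_ne _ hk]
  rw [hconj, det_mul, det_mul, mul_right_comm, hdet, one_mul, det_of_column_zero, hsub,
    det_diagonal]
  · rw [Matrix.add_apply, hcol]
    simp
  · intro i
    rw [Matrix.add_apply, hcol]
    simp

end LinearAlgebra

/-! ### Densities of Gaussian measures and linear changes of variables -/

section Densities

theorem _root_.MeasureTheory.MeasurePreserving.map_withDensity_comp {α β : Type*}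
    [MeasurableSpace α] [MeasurableSpace β] {μ : Measure α} {ν : Measure β} {e : α → β}
    (he : MeasurePreserving e μ ν) {f : β → ENNReal} (hf : Measurable f) :
    (μ.withDensity (fun x => f (e x))).map e = ν.withDensity f := by
  ext s hs
  rw [Measure.map_apply he.measurable hs, withDensity_apply _ (he.measurable hs),
    withDensity_apply _ hs, he.setLIntegral_comp_preimage hs hf]

theorem pi_withDensity_ofReal {ι α : Type*} [Fintype ι] [MeasurableSpace α] (μ : Measure α)
    [SigmaFinite μ] {g : α → ℝ} (hg0 : ∀ x, 0 ≤ g x) (hg : Integrable g μ) :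
    Measure.pi (fun _ : ι => μ.withDensity fun x => ENNReal.ofReal (g x)) =
      (Measure.pi fun _ : ι => μ).withDensity fun x => ENNReal.ofReal (∏ i, g (x i)) := by
  have := isFiniteMeasure_withDensity_ofReal hg.2
  refine Measure.pi_eq fun s hs => ?_
  have hind (i : ι) : Integrable ((s i).indicator g) μ := hg.indicator (hs i)
  have hprod (x : ι → α) : (Set.univ.pi s).indicator
      (fun x => ENNReal.ofReal (∏ i, g (x i))) x =
      ENNReal.ofReal (∏ i, (s i).indicator g (x i)) := by
    by_cases hx : x ∈ Set.univ.pi s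
    · rw [Set.indicator_of_mem hx]
      congr 1
      exact Finset.prod_congr rfl fun i _ => (Set.indicator_of_mem (hx i (Set.mem_univ i)) _).symm
    · rw [Set.indicator_of_notMem hx]
      obtain ⟨i, hi⟩ : ∃ i, x i ∉ s i := by simpa [Set.mem_pi] using hx
      rw [Finset.prod_eq_zero (Finset.mem_univ i) (Set.indicator_of_notMem hi _),
        ENNReal.ofReal_zero]
  rw [withDensity_apply _ (MeasurableSet.univ_pi hs), ← lintegral_indicator
    (MeasurableSet.univ_pi hs)]
  simp_rw [hprod]
  rw [← ofReal_integral_eq_lintegral_ofReal (Integrable.fintype_prod_dep hind)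
    (Filter.Eventually.of_forall fun x => Finset.prod_nonneg fun i _ =>
      Set.indicator_nonneg (fun y _ => hg0 y) _),
    integral_fintype_prod_eq_prod (fun i => (s i).indicator g),
    ENNReal.ofReal_prod_of_nonneg fun i _ => integral_nonneg
      fun x => Set.indicator_nonneg (fun y _ => hg0 y) _]
  refine Finset.prod_congr rfl fun i _ => ?_
  rw [withDensity_apply _ (hs i), integral_indicator (hs i),
    ofReal_integral_eq_lintegral_ofReal hg.restrict (Filter.Eventually.of_forall hg0)]

/-- The density of `stdComplexGaussian`. -/
noncomputable def gaussDensity (z : ℂ) : ℝ := Real.pi⁻¹ * Real.exp (-‖z‖ ^ 2)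

theorem gaussDensity_nonneg (z : ℂ) : 0 ≤ gaussDensity z := by
  unfold gaussDensity
  positivity

@[fun_prop]
theorem continuous_gaussDensity : Continuous gaussDensity := by
  unfold gaussDensity
  fun_prop

theorem stdComplexGaussian_eq_withDensity :
    stdComplexGaussian = volume.withDensity fun z => ENNReal.ofReal (gaussDensity z) := by
  have hs2 : Real.sqrt 2 ≠ 0 := by positivity
  have hT : (fun p : ℝ × ℝ => ((p.1 : ℂ) + Complex.I * (p.2 : ℂ)) / ((Real.sqrt 2 : ℝ) : ℂ)) =
      (fun z : ℂ => (Real.sqrt 2)⁻¹ • z) ∘ Complex.measurableEquivRealProd.symm := by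
    ext p
    rw [Function.comp_apply, Complex.measurableEquivRealProd_symm_apply, Complex.real_smul,
      div_eq_inv_mul, Complex.ofReal_inv]
    congr 1
    apply Complex.ext <;> simp
  have hpdf : (gaussianReal 0 1).prod (gaussianReal 0 1) =
      volume.withDensity fun p : ℝ × ℝ => ENNReal.ofReal
        (2⁻¹ * gaussDensity ((Real.sqrt 2)⁻¹ • Complex.measurableEquivRealProd.symm p)) := by
    rw [gaussianReal_of_var_ne_zero _ one_ne_zero, prod_withDensity
      (measurable_gaussianPDF _ _) (measurable_gaussianPDF _ _), ← Measure.volume_eq_prod]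
    congr 1
    ext p
    rw [gaussianPDF_def, ← ENNReal.ofReal_mul (gaussianPDFReal_nonneg _ _ _)]
    congr 1
    simp only [gaussianPDFReal, gaussDensity]
    rw [norm_smul, mul_pow, ← Complex.normSq_eq_norm_sq, Complex.normSq_apply,
      Complex.measurableEquivRealProd_symm_apply, norm_inv, Real.norm_eq_abs, inv_pow, sq_abs,
      Real.sq_sqrt (by norm_num)]
    simp only [NNReal.coe_one, mul_one, sub_zero]
    rw [mul_mul_mul_comm, ← Real.exp_add, ← mul_inv, Real.mul_self_sqrt (by positivity), mul_inv,
      mul_assoc]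
    congr 3
    ring
  rw [stdComplexGaussian, hT, ← Measure.map_map (by fun_prop)
    Complex.measurableEquivRealProd.symm.measurable, hpdf]
  have hvp : MeasurePreserving Complex.measurableEquivRealProd.symm volume volume :=
    Complex.volume_preserving_equiv_real_prod.symm
  rw [hvp.map_withDensity_comp (f := fun z : ℂ => ENNReal.ofReal
    (2⁻¹ * gaussDensity ((Real.sqrt 2)⁻¹ • z))) (by fun_prop)]
  have hmap := Measure.map_addHaar_smul (volume : Measure ℂ) (r := (Real.sqrt 2)⁻¹)
    (inv_ne_zero hs2)
  have hfac : ENNReal.ofReal |(((Real.sqrt 2)⁻¹) ^ Module.finrank ℝ ℂ)⁻¹| = 2 := by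
    rw [Complex.finrank_real_complex, inv_pow, inv_inv, Real.sq_sqrt (by norm_num)]
    simp
  rw [hfac] at hmap
  ext s hs
  have hm : Measurable fun z : ℂ => (Real.sqrt 2)⁻¹ • z := by fun_prop
  rw [Measure.map_apply hm hs, withDensity_apply _ (hm hs), withDensity_apply _ hs]
  rw [← setLIntegral_map hs (f := fun z : ℂ => ENNReal.ofReal (2⁻¹ * gaussDensity z))
    (by fun_prop) hm, hmap, Measure.restrict_smul, lintegral_smul_measure,
    smul_eq_mul, ← lintegral_const_mul _ (by fun_prop)]
  refine lintegral_congr fun z => ?_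
  rw [ENNReal.ofReal_mul (by norm_num), ← mul_assoc, ENNReal.ofReal_inv_of_pos (by norm_num)]
  simp [ENNReal.mul_inv_cancel]

theorem integrable_gaussDensity : Integrable gaussDensity volume := by
  refine ⟨by fun_prop, ?_⟩
  rw [hasFiniteIntegral_iff_ofReal (Filter.Eventually.of_forall gaussDensity_nonneg)]
  have h := measure_univ (μ := stdComplexGaussian)
  rw [stdComplexGaussian_eq_withDensity, withDensity_apply _ MeasurableSet.univ,
    Measure.restrict_univ] at h
  rw [h]
  exact ENNReal.one_lt_top

instance isAddHaarMeasure_volume_pi_pi {ι κ : Type*} [Fintype ι] [Fintype κ] :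
    (volume : Measure (ι → κ → ℂ)).IsAddHaarMeasure :=
  Measure.pi.isAddHaarMeasure _

theorem pi_stdComplexGaussian {κ : Type*} [Fintype κ] :
    (Measure.pi fun _ : κ => stdComplexGaussian) =
      volume.withDensity fun x : κ → ℂ => ENNReal.ofReal (∏ j, gaussDensity (x j)) := by
  rw [stdComplexGaussian_eq_withDensity,
    pi_withDensity_ofReal _ gaussDensity_nonneg integrable_gaussDensity]
  rfl

theorem pi_pi_stdComplexGaussian {ι κ : Type*} [Fintype ι] [Fintype κ] :
    (Measure.pi fun _ : ι => Measure.pi fun _ : κ => stdComplexGaussian) =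
      volume.withDensity fun x : ι → κ → ℂ =>
        ENNReal.ofReal (∏ i, ∏ j, gaussDensity (x i j)) := by
  rw [pi_stdComplexGaussian, pi_withDensity_ofReal (g := fun x : κ → ℂ => ∏ j, gaussDensity (x j))
    (volume : Measure (κ → ℂ)) (fun x => Finset.prod_nonneg fun j _ => gaussDensity_nonneg _)
    (Integrable.fintype_prod fun _ => integrable_gaussDensity)]
  rfl

theorem prod_gaussDensity {κ : Type*} [Fintype κ] (x : κ → ℂ) :
    ∏ j, gaussDensity (x j) = Real.pi⁻¹ ^ Fintype.card κ * Real.exp (-∑ j, ‖x j‖ ^ 2) := by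
  simp only [gaussDensity]
  rw [Finset.prod_mul_distrib, Finset.prod_const, ← Real.exp_sum, Finset.sum_neg_distrib,
    Finset.card_univ]

theorem prod_prod_gaussDensity {ι κ : Type*} [Fintype ι] [Fintype κ] (x : ι → κ → ℂ) :
    ∏ i, ∏ j, gaussDensity (x i j) =
      Real.pi⁻¹ ^ (Fintype.card ι * Fintype.card κ) * Real.exp (-∑ i, ∑ j, ‖x i j‖ ^ 2) := by
  simp_rw [prod_gaussDensity]
  rw [Finset.prod_mul_distrib, Finset.prod_const, ← Real.exp_sum, Finset.sum_neg_distrib,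
    Finset.card_univ, ← pow_mul, mul_comm (Fintype.card κ)]

/-- A matrix of size `n + 1`, split into its first column and the other columns. -/
abbrev Columns (n : ℕ) : Type := (Fin (n + 1) → ℂ) × (Fin (n + 1) → Fin n → ℂ)

instance isAddHaarMeasure_volume_columns {n : ℕ} :
    (volume : Measure (Columns n)).IsAddHaarMeasure :=
  Measure.prod.instIsAddHaarMeasure _ _

/-- The matrix with given first column and given other columns. -/
def ofColumns {n : ℕ} (x : Columns n) : Matrix (Fin (n + 1)) (Fin (n + 1)) ℂ :=
  of fun i => Fin.cons (x.1 i) (x.2 i)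

@[simp] theorem ofColumns_zero {n : ℕ} (x : Columns n) (i : Fin (n + 1)) :
    ofColumns x i 0 = x.1 i := rfl

@[simp] theorem ofColumns_succ {n : ℕ} (x : Columns n) (i : Fin (n + 1)) (j : Fin n) :
    ofColumns x i j.succ = x.2 i j := rfl

/-- `ofColumns` as a measurable equivalence. -/
noncomputable def columnsEquiv (n : ℕ) : (Fin (n + 1) → Fin (n + 1) → ℂ) ≃ᵐ Columns n :=
  (MeasurableEquiv.piCongrRight fun _ => MeasurableEquiv.piFinSuccAbove (fun _ => ℂ) 0).trans
    (MeasurableEquiv.arrowProdEquivProdArrow ℂ (Fin n → ℂ) (Fin (n + 1)))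

theorem columnsEquiv_symm {n : ℕ} : ⇑(columnsEquiv n).symm = ofColumns := by
  funext x
  exact (MeasurableEquiv.symm_apply_eq _).2 rfl

theorem measurePreserving_ofColumns {n : ℕ} :
    MeasurePreserving (β := Fin (n + 1) → Fin (n + 1) → ℂ) ofColumns volume volume := by
  rw [← columnsEquiv_symm]
  refine MeasurePreserving.symm _ (MeasurePreserving.trans ?_
    (volume_measurePreserving_arrowProdEquivProdArrow ℂ (Fin n → ℂ) (Fin (n + 1))))
  exact volume_preserving_pi fun _ => volume_preserving_piFinSuccAbove (fun _ => ℂ) 0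

theorem deformedGinibreLaw_eq_map {n : ℕ} (A : Matrix (Fin (n + 1)) (Fin (n + 1)) ℂ) :
    deformedGinibreLaw A = ((volume : Measure (Columns n)).withDensity fun x =>
      ENNReal.ofReal (∏ i, ∏ j, gaussDensity (ofColumns x i j - A i j))).map ofColumns := by
  let a : Fin (n + 1) → Fin (n + 1) → ℂ := A
  have hf : Measurable fun X : Fin (n + 1) → Fin (n + 1) → ℂ =>
      ENNReal.ofReal (∏ i, ∏ j, gaussDensity (X i j - a i j)) := by fun_prop
  refine Eq.trans ?_ (measurePreserving_ofColumns.map_withDensity_comp hf).symm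
  have htr : MeasurePreserving (fun G : Fin (n + 1) → Fin (n + 1) → ℂ => G + a) volume volume :=
    measurePreserving_add_right volume a
  refine Eq.trans ?_ (htr.map_withDensity_comp hf)
  simp only [Pi.add_apply, add_sub_cancel_right]
  rw [← pi_pi_stdComplexGaussian]
  rfl

theorem det_restrictScalars_real {V : Type*} [AddCommGroup V] [Module ℂ V] [Module ℝ V]
    [IsScalarTower ℝ ℂ V] (f : V →ₗ[ℂ] V) :
    LinearMap.det (f.restrictScalars ℝ) = ‖LinearMap.det f‖ ^ 2 := by
  rw [← Complex.normSq_eq_norm_sq, ← Algebra.norm_complex_apply]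
  exact LinearMap.det_restrictScalars

/-- A complex linear change of variables has real Jacobian `|det f|²`. -/
theorem lintegral_comp_linearMap {V : Type*} [NormedAddCommGroup V] [NormedSpace ℂ V]
    [FiniteDimensional ℂ V] [MeasurableSpace V] [BorelSpace V] (μ : Measure V)
    [μ.IsAddHaarMeasure] (f : V →ₗ[ℂ] V) (hf : LinearMap.det f ≠ 0) {F : V → ENNReal}
    (hF : Measurable F) :
    ∫⁻ x, F x ∂μ = ENNReal.ofReal (‖LinearMap.det f‖ ^ 2) * ∫⁻ x, F (f x) ∂μ := by
  have : FiniteDimensional ℝ V := FiniteDimensional.complexToReal V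
  have hdet := det_restrictScalars_real f
  have hne : LinearMap.det (f.restrictScalars ℝ) ≠ 0 := by
    rw [hdet]
    exact pow_ne_zero _ (norm_ne_zero_iff.2 hf)
  have hmap := Measure.map_linearMap_addHaar_eq_smul_addHaar μ hne
  have hmeas : Measurable f :=
    (f.restrictScalars ℝ).continuous_of_finiteDimensional.measurable
  have h := lintegral_map (μ := μ) hF hmeas
  change ∫⁻ x, F x ∂(Measure.map (f.restrictScalars ℝ) μ) = _ at h
  have hpos : 0 < ‖LinearMap.det f‖ ^ 2 := pow_pos (norm_pos_iff.2 hf) _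
  rw [← h, hmap, hdet, lintegral_smul_measure, abs_of_pos (inv_pos.2 hpos), smul_eq_mul,
    ← mul_assoc, ← ENNReal.ofReal_mul hpos.le, mul_inv_cancel₀ hpos.ne', ENNReal.ofReal_one,
    one_mul]

/-- The complex linear map `H ↦ U H S` on rectangular matrices, seen as functions of two indices. -/
def mulMulLinearMap {m n : ℕ} (U : Matrix (Fin m) (Fin m) ℂ) (S : Matrix (Fin n) (Fin n) ℂ) :
    (Fin m → Fin n → ℂ) →ₗ[ℂ] (Fin m → Fin n → ℂ) where
  toFun H := U * of H * S
  map_add' H K := by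
    change U * (of H + of K) * S = _
    rw [Matrix.mul_add, Matrix.add_mul]
    rfl
  map_smul' c H := by
    change U * (c • of H) * S = _
    rw [Matrix.mul_smul, Matrix.smul_mul]
    rfl

/-- Vectorization turns `H ↦ U H S` into the Kronecker product of `Sᵀ` and `U`. -/
theorem det_mulMulLinearMap {m n : ℕ} (U : Matrix (Fin m) (Fin m) ℂ)
    (S : Matrix (Fin n) (Fin n) ℂ) :
    LinearMap.det (mulMulLinearMap U S) = S.det ^ m * U.det ^ n := by
  let e : (Fin m → Fin n → ℂ) ≃ₗ[ℂ] (Fin n × Fin m → ℂ) :=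
    { toFun := fun H => (of H).vec
      map_add' := fun _ _ => rfl
      map_smul' := fun _ _ => rfl
      invFun := fun f i j => f (j, i)
      left_inv := fun _ => rfl
      right_inv := fun _ => rfl }
  have h : (e : (Fin m → Fin n → ℂ) →ₗ[ℂ] (Fin n × Fin m → ℂ)) ∘ₗ mulMulLinearMap U S ∘ₗ
      (e.symm : (Fin n × Fin m → ℂ) →ₗ[ℂ] (Fin m → Fin n → ℂ)) =
      toLin' (kroneckerMap (· * ·) Sᵀ U) := by
    refine LinearMap.ext fun x => ?_
    obtain ⟨H, rfl⟩ := e.surjective x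
    have := kronecker_mulVec_vec U (of H) Sᵀ
    rw [transpose_transpose] at this
    rw [LinearMap.comp_apply, LinearMap.comp_apply, LinearEquiv.coe_coe, LinearEquiv.coe_coe,
      LinearEquiv.symm_apply_apply, toLin'_apply]
    exact this.symm
  rw [← LinearMap.det_conj _ e, h, LinearMap.det_toLin', det_kronecker, det_transpose,
    Fintype.card_fin, Fintype.card_fin]

end Densities

/-! ### The eigenvector chart and its Jacobian -/

section Chart

/-- The vector `(1, y)`, where `p = (z, y)` collects an eigenvalue `z` and the affine coordinates
`y` of an eigenvector. -/
def chartVec {n : ℕ} (p : Fin (n + 1) → ℂ) : Fin (n + 1) → ℂ := Fin.cons 1 fun j => p j.succ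

@[simp] theorem chartVec_zero {n : ℕ} (p : Fin (n + 1) → ℂ) : chartVec p 0 = 1 := rfl

@[simp] theorem chartVec_succ {n : ℕ} (p : Fin (n + 1) → ℂ) (j : Fin n) :
    chartVec p j.succ = p j.succ := rfl

/-- The map `((z, y), B) ↦ (x, B)` to the matrix `(x | B)` which has `(1, y)` as an eigenvector
with eigenvalue `z`: its first column is `x = z (1, y) - B y`. -/
def eigenMap {n : ℕ} (x : Columns n) : Columns n :=
  (fun i => x.1 0 * chartVec x.1 i - ∑ j, x.2 i j * x.1 j.succ, x.2)

/-- The points over a matrix are its eigenpairs whose eigenvector has first entry `1`. -/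
theorem eigenMap_eq_iff {n : ℕ} (x y : Columns n) :
    eigenMap x = y ↔ x.2 = y.2 ∧ ofColumns y *ᵥ chartVec x.1 = x.1 0 • chartVec x.1 := by
  have h (hxy : x.2 = y.2) (i : Fin (n + 1)) :
      (ofColumns y *ᵥ chartVec x.1) i = y.1 i + ∑ j, x.2 i j * x.1 j.succ := by
    rw [mulVec, dotProduct, Fin.sum_univ_succ]
    simp [hxy]
  constructor
  · rintro rfl
    refine ⟨rfl, funext fun i => ?_⟩
    rw [h rfl]
    simp [eigenMap]
  · rintro ⟨hxy, he⟩
    refine Prod.ext (funext fun i => ?_) hxy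
    have := congrFun he i
    rw [h hxy] at this
    simp only [eigenMap]
    rw [← smul_eq_mul, ← Pi.smul_apply, ← this, add_sub_cancel_right]

/-- The complex Jacobian matrix of `(z, y) ↦ z (1, y) - B y`. -/
def chartJacobian {n : ℕ} (x : Columns n) : Matrix (Fin (n + 1)) (Fin (n + 1)) ℂ :=
  ofColumns (chartVec x.1, fun i j => (if i = j.succ then x.1 0 else 0) - x.2 i j)

/-- The derivative of `eigenMap`. -/
def eigenMapDeriv {n : ℕ} (x : Columns n) : Columns n →ₗ[ℂ] Columns n where
  toFun h := (fun i => (chartJacobian x *ᵥ h.1) i - ∑ j, h.2 i j * x.1 j.succ, h.2)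
  map_add' h k := by
    refine Prod.ext (funext fun i => ?_) rfl
    simp only [Prod.fst_add, Prod.snd_add, mulVec_add, Pi.add_apply, add_mul,
      Finset.sum_add_distrib]
    ring
  map_smul' c h := by
    refine Prod.ext (funext fun i => ?_) rfl
    simp only [Prod.smul_fst, Prod.smul_snd, mulVec_smul, Pi.smul_apply, smul_eq_mul, mul_assoc,
      RingHom.id_apply, mul_sub, Finset.mul_sum]

theorem chartJacobian_mulVec {n : ℕ} (x : Columns n) (q : Fin (n + 1) → ℂ) (i : Fin (n + 1)) :
    (chartJacobian x *ᵥ q) i = chartVec x.1 i * q 0 +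
      ∑ j, ((if i = j.succ then x.1 0 else 0) - x.2 i j) * q j.succ := by
  rw [mulVec, dotProduct, Fin.sum_univ_succ]
  rfl

theorem hasStrictFDerivAt_eigenMap {n : ℕ} (x : Columns n) :
    HasStrictFDerivAt (𝕜 := ℂ) eigenMap (LinearMap.toContinuousLinearMap (eigenMapDeriv x)) x := by
  have h1 (i : Fin (n + 1)) : HasStrictFDerivAt (𝕜 := ℂ) (fun y : Columns n => y.1 i)
      ((ContinuousLinearMap.proj (R := ℂ) (φ := fun _ : Fin (n + 1) => ℂ) i).comp
        (ContinuousLinearMap.fst ℂ (Fin (n + 1) → ℂ) (Fin (n + 1) → Fin n → ℂ))) x :=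
    ((ContinuousLinearMap.proj (R := ℂ) (φ := fun _ : Fin (n + 1) => ℂ) i).comp
        (ContinuousLinearMap.fst ℂ (Fin (n + 1) → ℂ)
          (Fin (n + 1) → Fin n → ℂ))).hasStrictFDerivAt
  have h2 (i : Fin (n + 1)) (j : Fin n) : HasStrictFDerivAt (𝕜 := ℂ)
      (fun y : Columns n => y.2 i j)
      (((ContinuousLinearMap.proj (R := ℂ) (φ := fun _ : Fin n => ℂ) j).comp
        (ContinuousLinearMap.proj (R := ℂ) (φ := fun _ : Fin (n + 1) => Fin n → ℂ) i)).comp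
        (ContinuousLinearMap.snd ℂ (Fin (n + 1) → ℂ) (Fin (n + 1) → Fin n → ℂ))) x :=
    (((ContinuousLinearMap.proj (R := ℂ) (φ := fun _ : Fin n => ℂ) j).comp
        (ContinuousLinearMap.proj (R := ℂ) (φ := fun _ : Fin (n + 1) => Fin n → ℂ) i)).comp
        (ContinuousLinearMap.snd ℂ (Fin (n + 1) → ℂ)
          (Fin (n + 1) → Fin n → ℂ))).hasStrictFDerivAt
  have hfst : HasStrictFDerivAt (𝕜 := ℂ) (fun y : Columns n => (eigenMap y).1)
      ((ContinuousLinearMap.fst ℂ (Fin (n + 1) → ℂ) (Fin (n + 1) → Fin n → ℂ)).comp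
        (LinearMap.toContinuousLinearMap (eigenMapDeriv x))) x := by
    rw [hasStrictFDerivAt_pi']
    intro i
    have hsum := HasStrictFDerivAt.fun_sum (u := Finset.univ)
      (fun (j : Fin n) _ => (h2 i j).mul (h1 j.succ))
    induction i using Fin.cases with
    | zero =>
      refine (((h1 0).mul (hasStrictFDerivAt_const (1 : ℂ) x)).sub hsum).congr_fderiv ?_
      refine ContinuousLinearMap.ext fun h => ?_
      simp [eigenMapDeriv, chartJacobian_mulVec, (Fin.succ_ne_zero _).symm,
        Finset.sum_add_distrib]
      simp only [mul_comm]
      ring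
    | succ k =>
      refine (((h1 0).mul (h1 k.succ)).sub hsum).congr_fderiv ?_
      refine ContinuousLinearMap.ext fun h => ?_
      simp [eigenMapDeriv, chartJacobian_mulVec, sub_mul, Finset.sum_add_distrib,
        Finset.sum_sub_distrib]
      simp only [mul_comm]
      ring
  exact hfst.prodMk (ContinuousLinearMap.snd ℂ (Fin (n + 1) → ℂ)
    (Fin (n + 1) → Fin n → ℂ)).hasStrictFDerivAt

theorem continuous_ofColumns {n : ℕ} : Continuous (ofColumns (n := n)) := by
  refine continuous_matrix fun i j => ?_
  induction j using Fin.cases with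
  | zero =>
    change Continuous fun x : Columns n => x.1 i
    fun_prop
  | succ j =>
    change Continuous fun x : Columns n => x.2 i j
    fun_prop

theorem continuous_eigenMap {n : ℕ} : Continuous (eigenMap (n := n)) :=
  continuous_iff_continuousAt.2 fun x => (hasStrictFDerivAt_eigenMap x).continuousAt

theorem continuous_chartVec {n : ℕ} : Continuous (chartVec (n := n)) := by
  refine continuous_pi fun i => ?_
  induction i using Fin.cases with
  | zero => exact continuous_const
  | succ k => exact continuous_apply k.succ

theorem continuous_chartJacobian {n : ℕ} : Continuous (chartJacobian (n := n)) := by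
  refine continuous_ofColumns.comp ((continuous_chartVec.comp continuous_fst).prodMk ?_)
  refine continuous_pi fun i => continuous_pi fun j => ?_
  split_ifs <;> fun_prop

/-- The derivative of `eigenMap` as a real linear map. -/
noncomputable def eigenMapRealDeriv {n : ℕ} (x : Columns n) : Columns n →L[ℝ] Columns n :=
  (LinearMap.toContinuousLinearMap (eigenMapDeriv x)).restrictScalars ℝ

theorem continuous_eigenMapRealDeriv {n : ℕ} :
    Continuous (eigenMapRealDeriv : Columns n → Columns n →L[ℝ] Columns n) := by
  rw [continuous_clm_apply]
  intro h
  change Continuous fun x : Columns n =>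
    ((fun i => (chartJacobian x *ᵥ h.1) i - ∑ j, h.2 i j * x.1 j.succ, h.2) : Columns n)
  simp_rw [chartJacobian_mulVec]
  refine Continuous.prodMk (continuous_pi fun i => ?_) continuous_const
  have hc : Continuous fun x : Columns n => chartVec x.1 i :=
    (continuous_apply i).comp (continuous_chartVec.comp continuous_fst)
  refine ((hc.mul continuous_const).add (continuous_finsetSum _ fun j _ => ?_)).sub
    (by fun_prop)
  split_ifs <;> fun_prop

/-- A unipotent block triangular endomorphism has determinant one. -/
theorem det_shear {V W : Type*} [AddCommGroup V] [Module ℂ V] [AddCommGroup W] [Module ℂ W]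
    (f : W →ₗ[ℂ] V) :
    LinearMap.det (LinearMap.id + LinearMap.inl ℂ V W ∘ₗ f ∘ₗ LinearMap.snd ℂ V W) = 1 := by
  set T : (W →ₗ[ℂ] V) → (V × W →ₗ[ℂ] V × W) := fun g =>
    LinearMap.id + LinearMap.inl ℂ V W ∘ₗ g ∘ₗ LinearMap.snd ℂ V W with hT
  have hadd (g h : W →ₗ[ℂ] V) : T g ∘ₗ T h = T (g + h) := by
    ext x <;> simp [hT, add_comm]
  let e : (V × W) ≃ₗ[ℂ] (V × W) := (LinearEquiv.neg ℂ).prodCongr (LinearEquiv.refl ℂ W)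
  have hneg (g : W →ₗ[ℂ] V) : (e : V × W →ₗ[ℂ] V × W) ∘ₗ T g ∘ₗ (e.symm : V × W →ₗ[ℂ] V × W) =
      T (-g) := by
    ext x <;> simp [hT, e]
  -- `T g` is conjugate to its inverse `T (-g)`, so that its determinant is `± 1`
  have hsq (g : W →ₗ[ℂ] V) : LinearMap.det (T g) * LinearMap.det (T g) = 1 := by
    nth_rewrite 2 [← LinearMap.det_conj (T g) e]
    rw [hneg, ← LinearMap.det_comp, hadd, add_neg_cancel]
    simp [hT]
  -- the sign is positive because `T f` is a square
  have hhalf : T f = T ((1 / 2 : ℂ) • f) ∘ₗ T ((1 / 2 : ℂ) • f) := by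
    rw [hadd, ← add_smul]
    norm_num
  change LinearMap.det (T f) = 1
  rw [hhalf, LinearMap.det_comp, hsq]

/-- The derivative of `eigenMap` is the product of a shear and `chartJacobian x ⊕ 1`. -/
theorem det_eigenMapDeriv {n : ℕ} (x : Columns n) :
    LinearMap.det (eigenMapDeriv x) = (chartJacobian x).det := by
  let f : (Fin (n + 1) → Fin n → ℂ) →ₗ[ℂ] (Fin (n + 1) → ℂ) :=
    { toFun := fun B i => -∑ j, B i j * x.1 j.succ
      map_add' := fun B C => by
        funext i
        simp [add_mul, Finset.sum_add_distrib, add_comm]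
      map_smul' := fun c B => by
        funext i
        simp [mul_assoc, Finset.mul_sum] }
  have h : eigenMapDeriv x = (LinearMap.id + LinearMap.inl ℂ _ _ ∘ₗ f ∘ₗ LinearMap.snd ℂ _ _) ∘ₗ
      ((toLin' (chartJacobian x)).prodMap LinearMap.id) := by
    refine LinearMap.ext fun h => ?_
    refine Prod.ext (funext fun i => ?_) ?_
    · simp [eigenMapDeriv, f, sub_eq_add_neg]
    · simp [eigenMapDeriv]
  rw [h, LinearMap.det_comp, det_shear, one_mul, LinearMap.det_prodMap, LinearMap.det_id, mul_one,
    LinearMap.det_toLin']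

theorem det_eigenMapRealDeriv {n : ℕ} (x : Columns n) :
    (eigenMapRealDeriv x).det = ‖(chartJacobian x).det‖ ^ 2 := by
  rw [← det_eigenMapDeriv]
  exact det_restrictScalars_real (eigenMapDeriv x)

end Chart

/-! ### Gaussian matrices with a prescribed eigenpair -/

section InnerIntegral

theorem sum_sum_sq_norm_eq_trace {m n : Type*} [Fintype m] [Fintype n] (M : Matrix m n ℂ) :
    ((∑ i, ∑ j, ‖M i j‖ ^ 2 : ℝ) : ℂ) = (Mᴴ * M).trace := by
  rw [trace, Finset.sum_comm]
  push_cast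
  refine Finset.sum_congr rfl fun j _ => ?_
  rw [diag_apply, mul_apply]
  exact Finset.sum_congr rfl fun i _ => by simp [Complex.conj_mul']

theorem sum_sum_sq_norm_unitary_mul_mul {ι : Type*} [Fintype ι] [DecidableEq ι]
    {U V : Matrix ι ι ℂ} (hU : Uᴴ * U = 1) (hV : Vᴴ * V = 1) (C : Matrix ι ι ℂ) :
    ∑ i, ∑ j, ‖(U * C * Vᴴ) i j‖ ^ 2 = ∑ i, ∑ j, ‖C i j‖ ^ 2 := by
  rw [← Complex.ofReal_inj, sum_sum_sq_norm_eq_trace, sum_sum_sq_norm_eq_trace]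
  have : (U * C * Vᴴ)ᴴ * (U * C * Vᴴ) = V * (Cᴴ * C * Vᴴ) := by
    rw [conjTranspose_mul, conjTranspose_mul, conjTranspose_conjTranspose]
    calc V * (Cᴴ * Uᴴ) * (U * C * Vᴴ) = V * (Cᴴ * (Uᴴ * U) * C * Vᴴ) := by
          simp only [Matrix.mul_assoc]
      _ = _ := by rw [hU, Matrix.mul_one]
  rw [this, trace_mul_comm, Matrix.mul_assoc, hV, Matrix.mul_one]

theorem sum_sq_norm_mulVec_unitary {ι : Type*} [Fintype ι] [DecidableEq ι]
    {U : Matrix ι ι ℂ} (hU : Uᴴ * U = 1) (x : ι → ℂ) :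
    ∑ i, ‖(Uᴴ *ᵥ x) i‖ ^ 2 = ∑ i, ‖x i‖ ^ 2 := by
  have hU' : U * Uᴴ = 1 := mul_eq_one_comm.1 hU
  have h (y : ι → ℂ) : ((∑ i, ‖y i‖ ^ 2 : ℝ) : ℂ) = star y ⬝ᵥ y := by
    simp [dotProduct, Complex.conj_mul']
  rw [← Complex.ofReal_inj, h, h, star_mulVec, conjTranspose_conjTranspose, dotProduct_mulVec,
    vecMul_vecMul, hU', vecMul_one]

theorem conjTranspose_mulVec_col_zero {n : ℕ} {V : Matrix (Fin (n + 1)) (Fin (n + 1)) ℂ}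
    (hV : Vᴴ * V = 1) {v : Fin (n + 1) → ℂ} (hV0 : ∀ i, V i 0 = v i) :
    Vᴴ *ᵥ v = Pi.single 0 1 := by
  funext i
  have h : (Vᴴ * V) i 0 = (Vᴴ *ᵥ v) i := by
    simp only [mul_apply, mulVec, dotProduct, hV0]
  rw [← h, hV, one_apply, Pi.single_apply]

/-- The matrix which differs from `A` by `U * C * Vᴴ`, where the last columns of `C` form the
parameter `H` and its first column is such that the first column of `V` is an eigenvector with
eigenvalue `z`. -/
def withEigenpair {n : ℕ} (A : Matrix (Fin (n + 1)) (Fin (n + 1)) ℂ) (z : ℂ)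
    (V U : Matrix (Fin (n + 1)) (Fin (n + 1)) ℂ) (H : Fin (n + 1) → Fin n → ℂ) :
    Matrix (Fin (n + 1)) (Fin (n + 1)) ℂ :=
  A + U * ofColumns (fun i => -(Uᴴ * shifted A z * V) i 0, H) * Vᴴ

variable {n : ℕ} {A : Matrix (Fin (n + 1)) (Fin (n + 1)) ℂ} {p v : Fin (n + 1) → ℂ}
  {V U : Matrix (Fin (n + 1)) (Fin (n + 1)) ℂ} {d : Fin n → ℂ}

theorem shifted_withEigenpair (hV : Vᴴ * V = 1) (hU : Uᴴ * U = 1) (z : ℂ)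
    (H : Fin (n + 1) → Fin n → ℂ) :
    shifted (withEigenpair A z V U H) z = U * ofColumns (0, fun i j =>
      (Uᴴ * shifted A z * V) i j.succ + H i j) * Vᴴ := by
  have hV' : V * Vᴴ = 1 := mul_eq_one_comm.1 hV
  have hU' : U * Uᴴ = 1 := mul_eq_one_comm.1 hU
  have h1 : ofColumns (0, fun i j => (Uᴴ * shifted A z * V) i j.succ + H i j) =
      Uᴴ * shifted A z * V + ofColumns (fun i => -(Uᴴ * shifted A z * V) i 0, H) := by
    ext i j
    induction j using Fin.cases with
    | zero => simp
    | succ j => simp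
  have h2 : U * (Uᴴ * shifted A z * V) * Vᴴ = shifted A z := by
    calc U * (Uᴴ * shifted A z * V) * Vᴴ = (U * Uᴴ) * shifted A z * (V * Vᴴ) := by
          simp only [Matrix.mul_assoc]
      _ = _ := by rw [hU', hV', Matrix.one_mul, Matrix.mul_one]
  rw [h1, Matrix.mul_add, Matrix.add_mul, h2, withEigenpair, shifted, shifted]
  abel

theorem ofColumns_zero_mulVec_single (B : Fin (n + 1) → Fin n → ℂ) :
    ofColumns (0, B) *ᵥ Pi.single 0 1 = 0 := by
  funext i
  simp [mulVec, dotProduct, Fin.sum_univ_succ]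

theorem chartVec_eq_smul (hv0 : v 0 ≠ 0) (hvp : ∀ i, v i = v 0 * chartVec p i) :
    chartVec p = (v 0)⁻¹ • v := by
  funext i
  rw [Pi.smul_apply, hvp i, smul_eq_mul, inv_mul_cancel_left₀ hv0]

/-- `withEigenpair A z V U H` has the prescribed eigenpair, hence it is recovered from its last
columns by `eigenMap`. -/
theorem eigenMap_withEigenpair (hV : Vᴴ * V = 1) (hU : Uᴴ * U = 1) (hV0 : ∀ i, V i 0 = v i)
    (hv0 : v 0 ≠ 0) (hvp : ∀ i, v i = v 0 * chartVec p i) (H : Fin (n + 1) → Fin n → ℂ) :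
    ofColumns (eigenMap (p, fun i j => withEigenpair A (p 0) V U H i j.succ)) =
      withEigenpair A (p 0) V U H := by
  set X := withEigenpair A (p 0) V U H with hX
  have hXc : ofColumns (fun i => X i 0, fun i j => X i j.succ) = X := by
    ext i j
    induction j using Fin.cases <;> rfl
  have h : shifted X (p 0) *ᵥ chartVec p = 0 := by
    rw [hX, shifted_withEigenpair hV hU, chartVec_eq_smul hv0 hvp, mulVec_smul, ← mulVec_mulVec,
      conjTranspose_mulVec_col_zero hV hV0, ← mulVec_mulVec, ofColumns_zero_mulVec_single,
      mulVec_zero, smul_zero]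
  have he : eigenMap (p, fun i j => X i j.succ) = (fun i => X i 0, fun i j => X i j.succ) := by
    rw [eigenMap_eq_iff]
    refine ⟨rfl, ?_⟩
    rw [hXc]
    rw [shifted, sub_mulVec, smul_mulVec, one_mulVec, sub_eq_zero] at h
    exact h
  rw [he, hXc]

/-- Multiplication by `Uᴴ` makes the first column of the Jacobian matrix a multiple of the first
unit vector. The factor `(v 0)⁻¹` cancels the determinant of the corner of `Vᴴ`. -/
theorem norm_det_chartJacobian_withEigenpair (hV : Vᴴ * V = 1) (hU : Uᴴ * U = 1)
    (hV0 : ∀ i, V i 0 = v i) (hU0 : ∀ i, U i 0 = v i)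
    (hd : (Uᴴ * shifted A (p 0) * V).submatrix Fin.succ Fin.succ = diagonal d)
    (hv0 : v 0 ≠ 0) (hvp : ∀ i, v i = v 0 * chartVec p i) (H : Fin (n + 1) → Fin n → ℂ) :
    ‖(chartJacobian (p, fun i j => withEigenpair A (p 0) V U H i j.succ)).det‖ =
      ‖(diagonal d + of fun i : Fin n => H i.succ).det‖ := by
  set X := withEigenpair A (p 0) V U H with hX
  set C : Matrix (Fin (n + 1)) (Fin (n + 1)) ℂ :=
    ofColumns (0, fun i j => (Uᴴ * shifted A (p 0) * V) i j.succ + H i j) with hC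
  have hjac : chartJacobian (p, fun i j => X i j.succ) =
      ofColumns (chartVec p, fun i j => -(shifted X (p 0)) i j.succ) := by
    ext i j
    induction j using Fin.cases with
    | zero => rfl
    | succ j => simp [chartJacobian, shifted, one_apply]
  have hmul : Uᴴ * chartJacobian (p, fun i j => X i j.succ) =
      ofColumns ((v 0)⁻¹ • Pi.single 0 1, fun i j => -(C * Vᴴ) i j.succ) := by
    have h1 : Uᴴ * shifted X (p 0) = C * Vᴴ := by
      rw [hX, shifted_withEigenpair hV hU, ← Matrix.mul_assoc, ← Matrix.mul_assoc, hU,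
        Matrix.one_mul]
    rw [hjac]
    ext i j
    induction j using Fin.cases with
    | zero =>
      rw [ofColumns_zero, ← conjTranspose_mulVec_col_zero hU hU0, ← mulVec_smul,
        ← chartVec_eq_smul hv0 hvp]
      rfl
    | succ j =>
      change _ = -(C * Vᴴ) i j.succ
      rw [← h1]
      simp only [mul_apply, ofColumns_succ, mul_neg, Finset.sum_neg_distrib]
  have hsub : (ofColumns ((v 0)⁻¹ • Pi.single 0 1,
      fun i j => -(C * Vᴴ) i j.succ)).submatrix Fin.succ Fin.succ =
      -((diagonal d + of fun i : Fin n => H i.succ) * Vᴴ.submatrix Fin.succ Fin.succ) := by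
    ext i j
    change -(C * Vᴴ) i.succ j.succ = -(_ * _ : Matrix (Fin n) (Fin n) ℂ) i j
    have hC0 : C i.succ 0 = 0 := rfl
    rw [mul_apply, mul_apply, Fin.sum_univ_succ, hC0, zero_mul, zero_add, ← hd]
    rfl
  have hdet : ‖(Uᴴ * chartJacobian (p, fun i j => X i j.succ)).det‖ =
      ‖(chartJacobian (p, fun i j => X i j.succ)).det‖ := by
    rw [det_mul, norm_mul, det_conjTranspose, norm_star, norm_det_eq_one hU, one_mul]
  rw [← hdet, hmul, det_of_column_zero, hsub, det_neg, ofColumns_zero, det_mul]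
  · simp [norm_det_submatrix_succ hV, hV0, mul_comm, hv0]
  · intro i
    simp

theorem sum_sum_sq_norm_ofColumns (x : Columns n) :
    ∑ i, ∑ j, ‖ofColumns x i j‖ ^ 2 = ∑ i, ‖x.1 i‖ ^ 2 + ∑ i, ∑ j, ‖x.2 i j‖ ^ 2 := by
  simp [Fin.sum_univ_succ (n := n), Finset.sum_add_distrib]
  ring

theorem sum_sq_norm_col_zero (hU : Uᴴ * U = 1) (hV0 : ∀ i, V i 0 = v i)
    (K : Matrix (Fin (n + 1)) (Fin (n + 1)) ℂ) :
    ∑ i, ‖-(Uᴴ * K * V) i 0‖ ^ 2 = ∑ i, ‖(K *ᵥ v) i‖ ^ 2 := by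
  rw [← sum_sq_norm_mulVec_unitary hU (K *ᵥ v)]
  refine Finset.sum_congr rfl fun i _ => ?_
  rw [norm_neg, Matrix.mul_assoc]
  congr 2
  simp only [mulVec, dotProduct, mul_apply, hV0]

/-- The Gaussian weight at a matrix with a given eigenpair, in the coordinates `H`. -/
theorem prod_gaussDensity_withEigenpair (hV : Vᴴ * V = 1) (hU : Uᴴ * U = 1)
    (hV0 : ∀ i, V i 0 = v i) (z : ℂ) (H : Fin (n + 1) → Fin n → ℂ) :
    ∏ i, ∏ j, gaussDensity (withEigenpair A z V U H i j - A i j) =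
      (Real.pi⁻¹ ^ (n + 1) * Real.exp (-∑ i, ‖(shifted A z *ᵥ v) i‖ ^ 2)) *
        ∏ i, ∏ j, gaussDensity (H i j) := by
  have h (i j) : withEigenpair A z V U H i j - A i j =
      (U * ofColumns (fun i => -(Uᴴ * shifted A z * V) i 0, H) * Vᴴ) i j := by
    rw [withEigenpair, Matrix.add_apply, add_sub_cancel_left]
  have h' : ∏ i, ∏ j, gaussDensity
      ((U * ofColumns (fun i => -(Uᴴ * shifted A z * V) i 0, H) * Vᴴ) i j) = _ :=
    prod_prod_gaussDensity fun i j =>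
      (U * ofColumns (fun i => -(Uᴴ * shifted A z * V) i 0, H) * Vᴴ) i j
  simp_rw [h]
  rw [h', prod_prod_gaussDensity, sum_sum_sq_norm_unitary_mul_mul hU hV,
    sum_sum_sq_norm_ofColumns, sum_sq_norm_col_zero hU hV0, neg_add, Real.exp_add,
    Fintype.card_fin, Fintype.card_fin]
  ring

theorem measurePreserving_tail_ginibre {n : ℕ} :
    MeasurePreserving (fun (H : Fin (n + 1) → Fin n → ℂ) (i : Fin n) => H i.succ)
      (Measure.pi fun _ => Measure.pi fun _ => stdComplexGaussian)
      (Measure.pi fun _ : Fin n => Measure.pi fun _ : Fin n => stdComplexGaussian) :=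
  measurePreserving_snd.comp (measurePreserving_piFinSuccAbove
    (fun _ : Fin (n + 1) => Measure.pi fun _ : Fin n => stdComplexGaussian) 0)

/-- For a fixed eigenpair, integrating out the free columns of the matrix yields the density in
the eigenvector chart. The free columns are `B = U H S + B₀`, where `S` is the lower right corner of
`Vᴴ`, and in terms of `H` the integral is the mean of `|det (D + G)|²` over Ginibre matrices `G`. -/
theorem lintegral_gaussDensity_mul_chartJacobian (hV : Vᴴ * V = 1) (hU : Uᴴ * U = 1)
    (hV0 : ∀ i, V i 0 = v i) (hU0 : ∀ i, U i 0 = v i)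
    (hd : (Uᴴ * shifted A (p 0) * V).submatrix Fin.succ Fin.succ = diagonal d)
    (hv0 : v 0 ≠ 0) (hvp : ∀ i, v i = v 0 * chartVec p i) :
    ∫⁻ B : Fin (n + 1) → Fin n → ℂ, ENNReal.ofReal (‖(chartJacobian (p, B)).det‖ ^ 2) *
        ENNReal.ofReal (∏ i, ∏ j, gaussDensity (ofColumns (eigenMap (p, B)) i j - A i j)) =
      ENNReal.ofReal (‖v 0‖ ^ (2 * (n + 1)) *
        (Real.pi⁻¹ ^ (n + 1) * Real.exp (-∑ i, ‖(shifted A (p 0) *ᵥ v) i‖ ^ 2) *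
          ∫ R in Set.Ioi (0 : ℝ), Real.exp (-R) * ∏ i, (R + ‖d i‖ ^ 2))) := by
  set F : (Fin (n + 1) → Fin n → ℂ) → ENNReal := fun B =>
    ENNReal.ofReal (‖(chartJacobian (p, B)).det‖ ^ 2) *
      ENNReal.ofReal (∏ i, ∏ j, gaussDensity (ofColumns (eigenMap (p, B)) i j - A i j)) with hF
  have hFm : Measurable F := by
    have h1 : Continuous fun B : Fin (n + 1) → Fin n → ℂ => chartJacobian (p, B) :=
      continuous_chartJacobian.comp (Continuous.prodMk_right p)
    have h2 (i j : Fin (n + 1)) : Continuous fun B : Fin (n + 1) → Fin n → ℂ =>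
        ofColumns (eigenMap (p, B)) i j :=
      (continuous_ofColumns.comp (continuous_eigenMap.comp (Continuous.prodMk_right p))).matrix_elem
        i j
    exact ((h1.matrix_det.norm.pow 2).measurable.ennreal_ofReal).mul
      ((continuous_finsetProd _ fun i _ => continuous_finsetProd _ fun j _ =>
        continuous_gaussDensity.comp ((h2 i j).sub continuous_const)).measurable.ennreal_ofReal)
  set S : Matrix (Fin n) (Fin n) ℂ := Vᴴ.submatrix Fin.succ Fin.succ with hS
  have hSdet : ‖S.det‖ = ‖v 0‖ := by rw [hS, norm_det_submatrix_succ hV, hV0]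
  have hLdet : ‖LinearMap.det (mulMulLinearMap U S)‖ = ‖v 0‖ ^ (n + 1) := by
    rw [det_mulMulLinearMap, norm_mul, norm_pow, norm_pow, norm_det_eq_one hU, hSdet, one_pow,
      mul_one]
  have hL0 : LinearMap.det (mulMulLinearMap U S) ≠ 0 := by
    rw [← norm_ne_zero_iff, hLdet]
    exact pow_ne_zero _ (norm_ne_zero_iff.2 hv0)
  set B0 : Fin (n + 1) → Fin n → ℂ := fun i j => withEigenpair A (p 0) V U 0 i j.succ with hB0
  have hB (H : Fin (n + 1) → Fin n → ℂ) : mulMulLinearMap U S H + B0 =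
      fun i j => withEigenpair A (p 0) V U H i j.succ := by
    have hsplit : withEigenpair A (p 0) V U H =
        U * ofColumns (0, H) * Vᴴ + withEigenpair A (p 0) V U 0 := by
      have : ofColumns (fun i => -(Uᴴ * shifted A (p 0) * V) i 0, H) = ofColumns (0, H) +
          ofColumns (fun i => -(Uᴴ * shifted A (p 0) * V) i 0, 0) := by
        ext i j
        induction j using Fin.cases with
        | zero => simp
        | succ j => simp
      rw [withEigenpair, withEigenpair, this, Matrix.mul_add, Matrix.add_mul]
      abel
    funext i j
    rw [hsplit]
    change (U * of H * S) i j + B0 i j = (U * ofColumns (0, H) * Vᴴ) i j.succ + B0 i j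
    congr 1
    rw [mul_apply, mul_apply, Fin.sum_univ_succ]
    have h0 : (U * ofColumns (0, H)) i 0 = 0 := by
      rw [mul_apply]
      simp
    rw [h0, zero_mul, zero_add]
    rfl
  have hFH (H : Fin (n + 1) → Fin n → ℂ) : F (mulMulLinearMap U S H + B0) =
      ENNReal.ofReal (Real.pi⁻¹ ^ (n + 1) * Real.exp (-∑ i, ‖(shifted A (p 0) *ᵥ v) i‖ ^ 2)) *
        (ENNReal.ofReal (∏ i, ∏ j, gaussDensity (H i j)) *
          ENNReal.ofReal (‖(diagonal d + of fun i : Fin n => H i.succ).det‖ ^ 2)) := by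
    rw [hB]
    simp only [hF]
    rw [norm_det_chartJacobian_withEigenpair hV hU hV0 hU0 hd hv0 hvp,
      eigenMap_withEigenpair hV hU hV0 hv0 hvp, prod_gaussDensity_withEigenpair hV hU hV0,
      ENNReal.ofReal_mul (by positivity)]
    ring
  have hdm : Measurable fun G : Fin n → Fin n → ℂ =>
      ENNReal.ofReal (‖(diagonal d + of G).det‖ ^ 2) := by
    have hc : Continuous fun G : Fin n → Fin n → ℂ => diagonal d + of G :=
      continuous_const.add continuous_id
    exact (hc.matrix_det.norm.pow 2).measurable.ennreal_ofReal
  have hgm : Measurable fun H : Fin (n + 1) → Fin n → ℂ =>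
      ENNReal.ofReal (∏ i, ∏ j, gaussDensity (H i j)) := by fun_prop
  have htail : Measurable fun (H : Fin (n + 1) → Fin n → ℂ) (i : Fin n) => H i.succ := by
    fun_prop
  rw [← lintegral_add_right_eq_self F B0, lintegral_comp_linearMap volume (mulMulLinearMap U S) hL0
    (F := fun x => F (x + B0)) (by fun_prop), hLdet]
  simp_rw [hFH]
  have h1 : ∫⁻ H : Fin (n + 1) → Fin n → ℂ, ENNReal.ofReal (∏ i, ∏ j, gaussDensity (H i j)) *
      ENNReal.ofReal (‖(diagonal d + of fun i : Fin n => H i.succ).det‖ ^ 2) =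
      ∫⁻ H : Fin (n + 1) → Fin n → ℂ,
        ENNReal.ofReal (‖(diagonal d + of fun i : Fin n => H i.succ).det‖ ^ 2)
        ∂(Measure.pi fun _ => Measure.pi fun _ => stdComplexGaussian) := by
    rw [pi_pi_stdComplexGaussian]
    exact (lintegral_withDensity_eq_lintegral_mul volume hgm (hdm.comp htail)).symm
  have h2 := measurePreserving_tail_ginibre.lintegral_comp hdm
  have h3 := lintegral_sq_norm_det_diagonal_add d
  have h4 := h1.trans (h2.trans h3)
  rw [lintegral_const_mul' _ _ ENNReal.ofReal_ne_top, h4, ← ENNReal.ofReal_mul (by positivity),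
    ← ENNReal.ofReal_mul (by positivity), ← pow_mul, mul_comm (n + 1) 2]

end InnerIntegral

/-! ### The uniform measure on the sphere in the affine chart -/

section Sphere

/-- The length of `(1, y)`, inverted. -/
noncomputable def chartScale {n : ℕ} (y : Fin n → ℂ) : ℝ := (Real.sqrt (1 + ∑ j, ‖y j‖ ^ 2))⁻¹

theorem one_add_sum_sq_norm_pos {n : ℕ} (y : Fin n → ℂ) : 0 < 1 + ∑ j, ‖y j‖ ^ 2 := by
  positivity

theorem chartScale_pos {n : ℕ} (y : Fin n → ℂ) : 0 < chartScale y :=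
  inv_pos.2 (Real.sqrt_pos.2 (one_add_sum_sq_norm_pos y))

theorem sq_chartScale {n : ℕ} (y : Fin n → ℂ) :
    chartScale y ^ 2 = (1 + ∑ j, ‖y j‖ ^ 2)⁻¹ := by
  rw [chartScale, inv_pow, Real.sq_sqrt (one_add_sum_sq_norm_pos y).le]

theorem norm_toLp_smul_cons {n : ℕ} (t : ℂ) (y : Fin n → ℂ) :
    ‖(WithLp.toLp 2 (t • (Fin.cons 1 y : Fin (n + 1) → ℂ)) : EuclideanSpace ℂ (Fin (n + 1)))‖ =
      ‖t‖ * (chartScale y)⁻¹ := by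
  rw [WithLp.toLp_smul, norm_smul, EuclideanSpace.norm_eq, chartScale, inv_inv]
  simp [Fin.sum_univ_succ]

theorem norm_exp_I_mul (θ : ℝ) : ‖Complex.exp (Complex.I * (θ : ℂ))‖ = 1 := by
  rw [mul_comm]
  exact Complex.norm_exp_ofReal_mul_I θ

/-- The unit vector proportional to `(1, y)` whose first entry has phase `θ`. -/
noncomputable def spherePoint {n : ℕ} (θ : ℝ) (y : Fin n → ℂ) : ComplexSphere (n + 1) :=
  ⟨WithLp.toLp 2 (((chartScale y : ℂ) * Complex.exp (Complex.I * (θ : ℂ))) •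
      (Fin.cons 1 y : Fin (n + 1) → ℂ)), by
    rw [mem_sphere_zero_iff_norm, norm_toLp_smul_cons, norm_mul, norm_exp_I_mul, mul_one,
      Complex.norm_real, Real.norm_of_nonneg (chartScale_pos y).le,
      mul_inv_cancel₀ (chartScale_pos y).ne']⟩

theorem spherePoint_apply {n : ℕ} (θ : ℝ) (y : Fin n → ℂ) (i : Fin (n + 1)) :
    (spherePoint θ y).1 i = ((chartScale y : ℂ) * Complex.exp (Complex.I * (θ : ℂ))) *
      (Fin.cons 1 y : Fin (n + 1) → ℂ) i := rfl

theorem spherePoint_zero {n : ℕ} (θ : ℝ) (y : Fin n → ℂ) :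
    (spherePoint θ y).1 0 = (chartScale y : ℂ) * Complex.exp (Complex.I * (θ : ℂ)) := by
  rw [spherePoint_apply, Fin.cons_zero, mul_one]

theorem norm_spherePoint_zero {n : ℕ} (θ : ℝ) (y : Fin n → ℂ) :
    ‖(spherePoint θ y).1 0‖ = chartScale y := by
  rw [spherePoint_zero, norm_mul, norm_exp_I_mul, mul_one, Complex.norm_real,
    Real.norm_of_nonneg (chartScale_pos y).le]

@[fun_prop]
theorem continuous_chartScale {n : ℕ} : Continuous (chartScale (n := n)) := by
  unfold chartScale
  refine Continuous.inv₀ (by fun_prop) fun y => ?_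
  exact (Real.sqrt_pos.2 (one_add_sum_sq_norm_pos y)).ne'

theorem continuous_spherePoint {n : ℕ} :
    Continuous fun q : ℝ × (Fin n → ℂ) => spherePoint q.1 q.2 := by
  have h : Continuous fun q : ℝ × (Fin n → ℂ) =>
      (chartScale q.2 : ℂ) * Complex.exp (Complex.I * (q.1 : ℂ)) := by fun_prop
  refine Continuous.subtype_mk ((PiLp.continuous_toLp 2 _).comp (h.smul ?_)) _
  refine continuous_pi fun i => ?_
  induction i using Fin.cases with
  | zero => exact continuous_const
  | succ j => exact (continuous_apply j).comp continuous_snd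

theorem spherePoint_periodic {n : ℕ} (y : Fin n → ℂ) :
    Function.Periodic (fun θ => spherePoint θ y) (2 * Real.pi) := by
  intro θ
  have h : Complex.exp (Complex.I * ((θ + 2 * Real.pi : ℝ) : ℂ)) =
      Complex.exp (Complex.I * (θ : ℂ)) := by
    rw [mul_comm, mul_comm Complex.I]
    push_cast
    rw [add_mul, Complex.exp_add, Complex.exp_two_pi_mul_I, mul_one]
  simp only [spherePoint, h]

theorem lintegral_uniformPhase {g : ℝ → ENNReal} (hg : Function.Periodic g (2 * Real.pi)) :
    ∫⁻ θ in Set.Ioo (-Real.pi) Real.pi, g θ =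
      ENNReal.ofReal (2 * Real.pi) * ∫⁻ θ, g θ ∂uniformPhase := by
  have hpi : 0 < 2 * Real.pi := by positivity
  have h1 := (isAddFundamentalDomain_Ioc hpi (-Real.pi)).setLIntegral_eq
    (isAddFundamentalDomain_Ioc hpi 0) g hg.map_vadd_zmultiples
  rw [zero_add, show -Real.pi + 2 * Real.pi = Real.pi by ring] at h1
  rw [uniformPhase, lintegral_smul_measure, smul_eq_mul, ← mul_assoc, ENNReal.mul_inv_cancel
    (by simpa using Real.pi_pos) ENNReal.ofReal_ne_top, one_mul,
    Measure.restrict_congr_set Ioo_ae_eq_Ioc, h1, Measure.restrict_congr_set Ico_ae_eq_Ioc]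

theorem lintegral_pi_fin_succ {n : ℕ} {G : (Fin (n + 1) → ℂ) → ENNReal} (hG : Measurable G) :
    ∫⁻ x, G x = ∫⁻ t : ℂ, ∫⁻ y : Fin n → ℂ, G (Fin.cons t y) := by
  have h := (volume_preserving_piFinSuccAbove (fun _ : Fin (n + 1) => ℂ) 0).symm
  rw [← h.lintegral_comp hG, Measure.volume_eq_prod, lintegral_prod]
  · refine lintegral_congr fun t => lintegral_congr fun y => ?_
    congr 1
    funext i
    exact Fin.cases rfl (fun _ => rfl) i
  · exact (hG.comp (MeasurableEquiv.measurable _)).aemeasurable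

/-- The radial Gaussian integral `∫₀^∞ r^(2n+1) exp (-b r²) dr = n! / (2 b^(n+1))`. -/
theorem lintegral_radial {n : ℕ} {b : ℝ} (hb : 0 < b) :
    ∫⁻ r in Set.Ioi (0 : ℝ), ENNReal.ofReal (r ^ (2 * n + 1) * Real.exp (-b * r ^ 2)) =
      ENNReal.ofReal (b⁻¹ ^ (n + 1) * (n.factorial / 2)) := by
  have hq : (-1 : ℝ) < ((2 * n + 1 : ℕ) : ℝ) := lt_of_lt_of_le (by norm_num) (Nat.cast_nonneg _)
  have h1 := integral_rpow_mul_exp_neg_mul_rpow (p := 2) (q := ((2 * n + 1 : ℕ) : ℝ)) two_pos hq hb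
  have h2 := integrableOn_rpow_mul_exp_neg_mul_rpow (p := 2) (s := ((2 * n + 1 : ℕ) : ℝ)) hq
    two_pos hb
  simp only [Real.rpow_natCast, Real.rpow_ofNat] at h1 h2
  rw [← ofReal_integral_eq_lintegral_ofReal h2]
  · congr 1
    rw [h1]
    have he : (((2 * n + 1 : ℕ) : ℝ) + 1) / 2 = ((n : ℝ) + 1) := by
      push_cast
      ring
    have he' : -(((2 * n + 1 : ℕ) : ℝ) + 1) / 2 = -((n + 1 : ℕ) : ℝ) := by
      push_cast
      ring
    rw [he, he', Real.Gamma_nat_eq_factorial, Real.rpow_neg hb.le, Real.rpow_natCast, inv_pow]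
    ring
  · filter_upwards [ae_restrict_mem measurableSet_Ioi] with r hr
    have : (0 : ℝ) < r := hr
    positivity

/-- Extension of a function on the sphere to the whole space, constant along rays. -/
noncomputable def radialExtend {N : ℕ} (f : ComplexSphere N → ENNReal) :
    EuclideanSpace ℂ (Fin N) → ENNReal :=
  Function.extend (Subtype.val : ({0}ᶜ : Set (EuclideanSpace ℂ (Fin N))) → _)
    (fun x => f ((homeomorphUnitSphereProd (EuclideanSpace ℂ (Fin N))) x).1) 0

theorem measurable_radialExtend {N : ℕ} {f : ComplexSphere N → ENNReal} (hf : Measurable f) :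
    Measurable (radialExtend f) :=
  (MeasurableEmbedding.subtype_coe (measurableSet_singleton _).compl).measurable_extend
    (hf.comp (measurable_fst.comp (Homeomorph.measurable _))) measurable_const

theorem radialExtend_smul {N : ℕ} (f : ComplexSphere N → ENNReal) {r : ℝ} (hr : 0 < r)
    (v : ComplexSphere N) : radialExtend f (r • v.1) = f v := by
  have hv : ‖v.1‖ = 1 := norm_eq_of_mem_sphere v
  have h0 : r • v.1 ≠ 0 := by
    rw [← norm_ne_zero_iff, norm_smul, hv, mul_one, Real.norm_of_nonneg hr.le]
    exact hr.ne'
  have h := Subtype.val_injective.extend_apply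
    (fun x : ({0}ᶜ : Set (EuclideanSpace ℂ (Fin N))) =>
      f ((homeomorphUnitSphereProd (EuclideanSpace ℂ (Fin N))) x).1) 0 ⟨r • v.1, h0⟩
  refine h.trans (congrArg f (Subtype.ext ?_))
  rw [homeomorphUnitSphereProd_apply_fst_coe, norm_smul, hv, mul_one, Real.norm_of_nonneg hr.le,
    smul_smul, inv_mul_cancel₀ hr.ne', one_smul]

/-- The Gaussian integral of a radial extension, in polar coordinates. -/
theorem lintegral_exp_mul_radialExtend {N : ℕ} [NeZero N]
    (μ : Measure (EuclideanSpace ℂ (Fin N))) [μ.IsAddHaarMeasure]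
    {f : ComplexSphere N → ENNReal} (hf : Measurable f) :
    ∫⁻ x, ENNReal.ofReal (Real.exp (-‖x‖ ^ 2)) * radialExtend f x ∂μ =
      (∫⁻ v, f v ∂μ.toSphere) * ∫⁻ r : Set.Ioi (0 : ℝ), ENNReal.ofReal (Real.exp (-r.1 ^ 2))
        ∂(Measure.volumeIoiPow (Module.finrank ℝ (EuclideanSpace ℂ (Fin N)) - 1)) := by
  have hmp := μ.measurePreserving_homeomorphUnitSphereProd
  have hg : Measurable fun r : Set.Ioi (0 : ℝ) => ENNReal.ofReal (Real.exp (-r.1 ^ 2)) := by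
    fun_prop
  rw [← lintegral_prod_mul hf.aemeasurable hg.aemeasurable, ← hmp.lintegral_comp
    (f := fun q => f q.1 * ENNReal.ofReal (Real.exp (-q.2.1 ^ 2)))
    ((hf.comp measurable_fst).mul (hg.comp measurable_snd)),
    ← setLIntegral_eq_of_support_subset (s := {0}ᶜ), ← lintegral_subtype_comap
    (measurableSet_singleton _).compl]
  · refine lintegral_congr fun x => ?_
    rw [mul_comm]
    congr 1
    · exact Subtype.val_injective.extend_apply _ _ x
    · rw [homeomorphUnitSphereProd_apply_snd_coe]
  · intro x hx h0
    refine hx ?_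
    have : radialExtend f x = 0 := by
      refine Function.extend_apply' _ _ _ ?_
      rintro ⟨y, rfl⟩
      exact y.2 h0
    simp only [this, mul_zero]

theorem chart_smul_eq {n : ℕ} {r : ℝ} (θ : ℝ) (y : Fin n → ℂ) :
    WithLp.toLp 2 (((r : ℂ) * Complex.exp (Complex.I * (θ : ℂ))) •
      (Fin.cons 1 y : Fin (n + 1) → ℂ)) = (r * (chartScale y)⁻¹) • (spherePoint θ y).1 := by
  have hc : (chartScale y : ℂ) ≠ 0 := Complex.ofReal_ne_zero.2 (chartScale_pos y).ne'
  ext i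
  rw [PiLp.smul_apply, spherePoint_apply, Complex.real_smul, Complex.ofReal_mul,
    Complex.ofReal_inv]
  simp only [Pi.smul_apply, smul_eq_mul]
  field_simp

/-- Polar coordinates for the first coordinate, in the ray through `(1, y)`. -/
theorem lintegral_ray {n : ℕ} {f : ComplexSphere (n + 1) → ENNReal} (hf : Measurable f)
    (y : Fin n → ℂ) :
    ∫⁻ t : ℂ, ENNReal.ofReal (‖t‖ ^ (2 * n)) *
      (ENNReal.ofReal (Real.exp (-‖(WithLp.toLp 2 (t • (Fin.cons 1 y : Fin (n + 1) → ℂ)) :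
        EuclideanSpace ℂ (Fin (n + 1)))‖ ^ 2)) *
        radialExtend f (WithLp.toLp 2 (t • (Fin.cons 1 y : Fin (n + 1) → ℂ)))) =
    ENNReal.ofReal (n.factorial * Real.pi) * (ENNReal.ofReal (chartScale y ^ (2 * (n + 1))) *
      ∫⁻ θ, f (spherePoint θ y) ∂uniformPhase) := by
  have hb := one_add_sum_sq_norm_pos y
  set b := 1 + ∑ j, ‖y j‖ ^ 2 with hbdef
  have hcb : ((chartScale y)⁻¹) ^ 2 = b := by rw [inv_pow, sq_chartScale, inv_inv]
  rw [← Complex.lintegral_comp_polarCoord_symm]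
  have hpt : ∀ q ∈ polarCoord.target, ENNReal.ofReal q.1 •
      (ENNReal.ofReal (‖Complex.polarCoord.symm q‖ ^ (2 * n)) *
      (ENNReal.ofReal (Real.exp (-‖(WithLp.toLp 2 (Complex.polarCoord.symm q •
        (Fin.cons 1 y : Fin (n + 1) → ℂ)) : EuclideanSpace ℂ (Fin (n + 1)))‖ ^ 2)) *
        radialExtend f (WithLp.toLp 2 (Complex.polarCoord.symm q •
          (Fin.cons 1 y : Fin (n + 1) → ℂ))))) =
      ENNReal.ofReal (q.1 ^ (2 * n + 1) * Real.exp (-b * q.1 ^ 2)) * f (spherePoint q.2 y) := by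
    rintro ⟨r, θ⟩ hq
    have hr : 0 < r := hq.1
    have ht : Complex.polarCoord.symm (r, θ) = (r : ℂ) * Complex.exp (Complex.I * (θ : ℂ)) := by
      rw [Complex.polarCoord_symm_apply, mul_comm Complex.I, Complex.exp_mul_I]
      simp
    have hn : ‖(r : ℂ) * Complex.exp (Complex.I * (θ : ℂ))‖ = r := by
      rw [norm_mul, norm_exp_I_mul, mul_one, Complex.norm_real, Real.norm_of_nonneg hr.le]
    rw [ht, norm_toLp_smul_cons, hn, mul_pow, hcb, chart_smul_eq,
      radialExtend_smul f (mul_pos hr (inv_pos.2 (chartScale_pos y))), smul_eq_mul,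
      ← mul_assoc, ← mul_assoc, ← ENNReal.ofReal_mul hr.le, ← ENNReal.ofReal_mul (by positivity)]
    congr 3
    · ring
    · ring_nf
  have hgm : Measurable fun θ => f (spherePoint θ y) :=
    hf.comp (continuous_spherePoint.comp (Continuous.prodMk_left y)).measurable
  have hrm : Measurable fun r : ℝ =>
      ENNReal.ofReal (r ^ (2 * n + 1) * Real.exp (-b * r ^ 2)) := by fun_prop
  have htarget : polarCoord.target = Set.Ioi (0 : ℝ) ×ˢ Set.Ioo (-Real.pi) Real.pi := rfl
  rw [setLIntegral_congr_fun polarCoord.open_target.measurableSet hpt, htarget,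
    Measure.volume_eq_prod, ← Measure.prod_restrict,
    lintegral_prod_mul (f := fun r : ℝ => ENNReal.ofReal (r ^ (2 * n + 1) * Real.exp (-b * r ^ 2)))
      (g := fun θ => f (spherePoint θ y)) hrm.aemeasurable hgm.aemeasurable,
    lintegral_radial hb, lintegral_uniformPhase (fun θ => congrArg f (spherePoint_periodic y θ)),
    ← mul_assoc, ← mul_assoc, ← ENNReal.ofReal_mul (by positivity),
    ← ENNReal.ofReal_mul (by positivity), pow_mul, sq_chartScale]
  congr 2
  ring

/-- The Gaussian integral of a radial extension, in the coordinates `x = t (1, y)`. -/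
theorem lintegral_exp_mul_radialExtend_chart {n : ℕ} {f : ComplexSphere (n + 1) → ENNReal}
    (hf : Measurable f) :
    ∫⁻ x : Fin (n + 1) → ℂ, ENNReal.ofReal (Real.exp (-‖(WithLp.toLp 2 x :
      EuclideanSpace ℂ (Fin (n + 1)))‖ ^ 2)) * radialExtend f (WithLp.toLp 2 x) =
    ENNReal.ofReal (n.factorial * Real.pi) * ∫⁻ y : Fin n → ℂ,
      ENNReal.ofReal (chartScale y ^ (2 * (n + 1))) *
        ∫⁻ θ, f (spherePoint θ y) ∂uniformPhase := by
  set G : (Fin (n + 1) → ℂ) → ENNReal := fun x =>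
    ENNReal.ofReal (Real.exp (-‖(WithLp.toLp 2 x : EuclideanSpace ℂ (Fin (n + 1)))‖ ^ 2)) *
      radialExtend f (WithLp.toLp 2 x) with hGdef
  have hlp : Continuous fun x : Fin (n + 1) → ℂ =>
      (WithLp.toLp 2 x : EuclideanSpace ℂ (Fin (n + 1))) := PiLp.continuous_toLp 2 _
  have hG : Measurable G :=
    ((hlp.norm.pow 2).neg.rexp.measurable.ennreal_ofReal).mul
      ((measurable_radialExtend hf).comp hlp.measurable)
  have hcons : Continuous fun q : ℂ × (Fin n → ℂ) => (Fin.cons q.1 q.2 : Fin (n + 1) → ℂ) := by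
    refine continuous_pi fun i => ?_
    induction i using Fin.cases with
    | zero => exact continuous_fst
    | succ j => exact (continuous_apply j).comp continuous_snd
  have hcons1 : Continuous fun q : ℂ × (Fin n → ℂ) =>
      q.1 • (Fin.cons 1 q.2 : Fin (n + 1) → ℂ) :=
    continuous_fst.smul (hcons.comp (continuous_const.prodMk continuous_snd))
  rw [lintegral_pi_fin_succ hG]
  have hscale (t : ℂ) (ht : t ≠ 0) : ∫⁻ y : Fin n → ℂ, G (Fin.cons t y) =
      ∫⁻ y : Fin n → ℂ, ENNReal.ofReal (‖t‖ ^ (2 * n)) *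
        G (t • (Fin.cons 1 y : Fin (n + 1) → ℂ)) := by
    have hdet : LinearMap.det (t • (LinearMap.id : (Fin n → ℂ) →ₗ[ℂ] (Fin n → ℂ))) = t ^ n := by
      rw [LinearMap.det_smul, LinearMap.det_id, mul_one, Module.finrank_fin_fun]
    rw [lintegral_comp_linearMap volume (t • (LinearMap.id : (Fin n → ℂ) →ₗ[ℂ] (Fin n → ℂ)))
      (by rw [hdet]; exact pow_ne_zero _ ht) (F := fun y => G (Fin.cons t y))
      (hG.comp (hcons.comp (Continuous.prodMk_right t)).measurable), hdet,
      lintegral_const_mul' _ _ ENNReal.ofReal_ne_top, norm_pow, ← pow_mul, mul_comm n 2]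
    congr 2
    funext y
    congr 1
    funext i
    induction i using Fin.cases <;> simp
  have hae : ∀ᵐ t : ℂ, t ≠ 0 := compl_mem_ae_iff.2 (measure_singleton 0)
  rw [lintegral_congr_ae (hae.mono fun t ht => hscale t ht), lintegral_lintegral_swap]
  · simp_rw [hGdef, lintegral_ray hf]
    rw [lintegral_const_mul' _ _ ENNReal.ofReal_ne_top]
  · exact (((continuous_fst.norm.pow (2 * n)).measurable.ennreal_ofReal).mul
      (hG.comp hcons1.measurable)).aemeasurable

theorem lintegral_exp_neg_sq_norm {n : ℕ} :
    ∫⁻ x : Fin n → ℂ, ENNReal.ofReal (Real.exp (-‖(WithLp.toLp 2 x :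
      EuclideanSpace ℂ (Fin n))‖ ^ 2)) = ENNReal.ofReal (Real.pi ^ n) := by
  have h := measure_univ (μ := Measure.pi fun _ : Fin n => stdComplexGaussian)
  rw [pi_stdComplexGaussian, withDensity_apply _ MeasurableSet.univ, Measure.restrict_univ] at h
  simp_rw [prod_gaussDensity, ENNReal.ofReal_mul (pow_nonneg (inv_nonneg.2 Real.pi_pos.le) _)] at h
  rw [lintegral_const_mul' _ _ ENNReal.ofReal_ne_top, Fintype.card_fin] at h
  simp_rw [EuclideanSpace.norm_sq_eq]
  have hc : ENNReal.ofReal (Real.pi ^ n) * ENNReal.ofReal (Real.pi⁻¹ ^ n) = 1 := by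
    rw [← ENNReal.ofReal_mul (by positivity), ← mul_pow, mul_inv_cancel₀ Real.pi_pos.ne', one_pow,
      ENNReal.ofReal_one]
  calc _ = (ENNReal.ofReal (Real.pi ^ n) * ENNReal.ofReal (Real.pi⁻¹ ^ n)) *
        ∫⁻ x : Fin n → ℂ, ENNReal.ofReal (Real.exp (-∑ j, ‖x j‖ ^ 2)) := by rw [hc, one_mul]
    _ = _ := by rw [mul_assoc, h, mul_one]

/-- The uniform measure on the sphere in the coordinates `(θ, y)`: the Gaussian integral of a radial extension is
computed in polar coordinates and in the chart. -/
theorem lintegral_haarSphere {n : ℕ} {f : ComplexSphere (n + 1) → ENNReal} (hf : Measurable f) :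
    ENNReal.ofReal (Real.pi ^ (n + 1)) * ∫⁻ v, f v ∂(haarSphere (n + 1)) =
      ENNReal.ofReal (n.factorial * Real.pi) * ∫⁻ y : Fin n → ℂ,
        ENNReal.ofReal (chartScale y ^ (2 * (n + 1))) *
          ∫⁻ θ, f (spherePoint θ y) ∂uniformPhase := by
  set μ : Measure (EuclideanSpace ℂ (Fin (n + 1))) := volume with hμ
  set e : (Fin (n + 1) → ℂ) ≃L[ℝ] EuclideanSpace ℂ (Fin (n + 1)) :=
    (PiLp.continuousLinearEquiv 2 ℝ fun _ : Fin (n + 1) => ℂ).symm with he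
  set ν : Measure (EuclideanSpace ℂ (Fin (n + 1))) := Measure.map e volume with hν
  have : ν.IsAddHaarMeasure := e.isAddHaarMeasure_map volume
  -- the normalization of Lebesgue measure on Euclidean space cancels, so `c` need not be computed
  set c := Measure.addHaarScalarFactor μ ν with hc
  have hμν : μ = c • ν := Measure.isAddLeftInvariant_eq_smul μ ν
  have hc0 : (c : ENNReal) ≠ 0 := by
    simpa using (Measure.addHaarScalarFactor_pos_of_isAddHaarMeasure μ ν).ne'
  have hint (F : EuclideanSpace ℂ (Fin (n + 1)) → ENNReal) (hF : Measurable F) :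
      ∫⁻ x, F x ∂μ = c * ∫⁻ x : Fin (n + 1) → ℂ, F (WithLp.toLp 2 x) := by
    have : ∫⁻ x, F x ∂μ = c * ∫⁻ x, F x ∂ν := by
      rw [hμν]
      exact lintegral_smul_measure _ _
    rw [this, hν, lintegral_map hF e.continuous.measurable]
    rfl
  have hexp : Measurable fun x : EuclideanSpace ℂ (Fin (n + 1)) =>
      ENNReal.ofReal (Real.exp (-‖x‖ ^ 2)) := by fun_prop
  have h1 := lintegral_exp_mul_radialExtend μ hf
  rw [hint (fun x => ENNReal.ofReal (Real.exp (-‖x‖ ^ 2)) * radialExtend f x)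
    (hexp.mul (measurable_radialExtend hf)), lintegral_exp_mul_radialExtend_chart hf] at h1
  have h2 := lintegral_exp_mul_radialExtend μ (measurable_const (a := (1 : ENNReal)))
  have h3 : ∫⁻ x, ENNReal.ofReal (Real.exp (-‖x‖ ^ 2)) * radialExtend (fun _ => 1) x ∂μ =
      ∫⁻ x, ENNReal.ofReal (Real.exp (-‖x‖ ^ 2)) ∂μ := by
    have hae : ∀ᵐ x ∂μ, x ≠ 0 := compl_mem_ae_iff.2 (measure_singleton 0)
    refine lintegral_congr_ae (hae.mono fun x hx => ?_)
    have : radialExtend (fun _ => 1) x = 1 :=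
      Subtype.val_injective.extend_apply _ _
        (⟨x, hx⟩ : ({0}ᶜ : Set (EuclideanSpace ℂ (Fin (n + 1)))))
    simp only [this, mul_one]
  rw [h3, hint _ hexp, lintegral_exp_neg_sq_norm, lintegral_one] at h2
  have hts0 : μ.toSphere Set.univ ≠ 0 := by
    rw [Measure.measure_univ_ne_zero]
    exact Measure.toSphere_ne_zero μ
  have htst : μ.toSphere Set.univ ≠ ⊤ := measure_ne_top _ _
  refine (ENNReal.mul_right_inj hc0 ENNReal.coe_ne_top).1 ?_
  have halg (u i k : ENNReal) : u * k * (u⁻¹ * i) = u * u⁻¹ * (i * k) := by ring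
  rw [h1, ← mul_assoc, h2, haarSphere, lintegral_smul_measure, smul_eq_mul, ← hμ, halg,
    ENNReal.mul_inv_cancel hts0 htst, one_mul]

end Sphere

/-! ### Eigenpairs as a fibre of the chart map -/

section Eigenpairs

variable {n : ℕ}

/-- The matrix has no eigenvector with vanishing first entry. -/
def NoDegenerateEigenvector (X : Matrix (Fin (n + 1)) (Fin (n + 1)) ℂ) : Prop :=
  ∀ (z : ℂ) (w : Fin (n + 1) → ℂ), X *ᵥ w = z • w → w 0 = 0 → w = 0

theorem ofColumns_injective : Function.Injective (ofColumns (n := n)) := by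
  intro x y h
  refine Prod.ext (funext fun i => congrFun (congrFun h i) 0)
    (funext fun i => funext fun j => congrFun (congrFun h i) j.succ)

/-- Conjugation of a matrix by a permutation of the indices, as a linear map. -/
def permuteColumns (π : Equiv.Perm (Fin (n + 1))) : Columns n →ₗ[ℝ] Columns n where
  toFun x := (fun i => ofColumns x (π i) (π 0), fun i j => ofColumns x (π i) (π j.succ))
  map_add' x y := by
    have h (i j : Fin (n + 1)) : ofColumns (x + y) i j = ofColumns x i j + ofColumns y i j := by
      induction j using Fin.cases <;> rfl
    refine Prod.ext (funext fun i => h _ _) (funext fun i => funext fun j => h _ _)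
  map_smul' c x := by
    have h (i j : Fin (n + 1)) : ofColumns (c • x) i j = c • ofColumns x i j := by
      induction j using Fin.cases <;> rfl
    refine Prod.ext (funext fun i => h _ _) (funext fun i => funext fun j => h _ _)

theorem ofColumns_permuteColumns (π : Equiv.Perm (Fin (n + 1))) (x : Columns n) :
    ofColumns (permuteColumns π x) = (ofColumns x).submatrix π π := by
  ext i j
  induction j using Fin.cases <;> rfl

/-- The chart points whose `j`-th affine coordinate vanishes form a null set. -/
theorem volume_coordinate_eq_zero (j : Fin n) :
    (volume : Measure (Columns n)) {x | x.1 j.succ = 0} = 0 := by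
  let l : Columns n →ₗ[ℝ] ℂ :=
    { toFun := fun x => x.1 j.succ
      map_add' := fun _ _ => rfl
      map_smul' := fun _ _ => rfl }
  refine Measure.addHaar_submodule volume (LinearMap.ker l) fun h => ?_
  have : ((Pi.single j.succ 1, 0) : Columns n) ∈ LinearMap.ker l := by
    rw [h]
    trivial
  simp [l] at this

theorem eigenMap_of_mulVec_eq {y : Columns n} {z : ℂ} {w : Fin (n + 1) → ℂ}
    (h : ofColumns y *ᵥ w = z • w) (hw : w 0 ≠ 0) :
    eigenMap (Fin.cons z fun j => (w 0)⁻¹ * w j.succ, y.2) = y := by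
  rw [eigenMap_eq_iff]
  refine ⟨rfl, ?_⟩
  have hu : chartVec (Fin.cons z fun j => (w 0)⁻¹ * w j.succ) = (w 0)⁻¹ • w := by
    funext i
    induction i using Fin.cases with
    | zero => simp [hw]
    | succ j => simp
  simp only
  rw [hu, mulVec_smul, h, Fin.cons_zero, smul_comm]

/-- If `w 0 = 0` and `w j ≠ 0` for an eigenvector `w`, exchanging the indices `0` and `j` gives a
matrix with an eigenvector in the chart which has a vanishing affine coordinate. Such matrices form
the image of a null set under a smooth map. -/
theorem ae_noDegenerateEigenvector :
    ∀ᵐ y : Columns n, NoDegenerateEigenvector (ofColumns y) := by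
  have hnull (j : Fin n) : ∀ᵐ y : Columns n, y ∉
      (permuteColumns (Equiv.swap 0 j.succ) ∘ eigenMap) '' {x : Columns n | x.1 j.succ = 0} := by
    refine measure_eq_zero_iff_ae_notMem.1 ?_
    refine addHaar_image_eq_zero_of_differentiableOn_of_addHaar_eq_zero volume ?_
      (volume_coordinate_eq_zero j)
    refine Differentiable.differentiableOn ?_
    refine (LinearMap.toContinuousLinearMap
      (permuteColumns (Equiv.swap 0 j.succ))).differentiable.comp fun x => ?_
    exact ((hasStrictFDerivAt_eigenMap x).hasFDerivAt.restrictScalars ℝ).differentiableAt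
  filter_upwards [ae_all_iff.2 hnull] with y hy z w hzw hw0
  by_contra hw
  obtain ⟨i, hi⟩ : ∃ i, w i ≠ 0 := Function.ne_iff.1 hw
  induction i using Fin.cases with
  | zero => exact hi hw0
  | succ j =>
    set π := Equiv.swap (0 : Fin (n + 1)) j.succ with hπ
    have h1 : ofColumns (permuteColumns π y) *ᵥ (w ∘ π) = z • (w ∘ π) := by
      rw [ofColumns_permuteColumns, submatrix_mulVec_equiv, Function.comp_assoc,
        Equiv.self_comp_symm, Function.comp_id, hzw]
      rfl
    have h2 : (w ∘ π) 0 ≠ 0 := by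
      rw [Function.comp_apply, hπ, Equiv.swap_apply_left]
      exact hi
    have h3 := eigenMap_of_mulVec_eq h1 h2
    have h4 : (w ∘ π) j.succ = 0 := by
      rw [Function.comp_apply, hπ, Equiv.swap_apply_right]
      exact hw0
    have h5 : permuteColumns π (permuteColumns π y) = y := by
      refine ofColumns_injective ?_
      rw [ofColumns_permuteColumns, ofColumns_permuteColumns]
      ext a b
      simp only [submatrix_apply, hπ, Equiv.swap_apply_self]
    refine hy j ⟨_, ?_, (congrArg (permuteColumns π) h3).trans h5⟩
    change ((w ∘ π) 0)⁻¹ * (w ∘ π) j.succ = 0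
    rw [h4, mul_zero]

/-- The eigenpair with phase `θ` which corresponds to a point of the chart. -/
noncomputable def chartEigenpair (q : Fin (n + 1) → ℂ) (θ : ℝ) : ℂ × ComplexSphere (n + 1) :=
  (q 0, spherePoint θ (Fin.tail q))

theorem continuous_chartEigenpair :
    Continuous fun a : (Fin (n + 1) → ℂ) × ℝ => chartEigenpair a.1 a.2 := by
  have h1 : Continuous fun a : (Fin (n + 1) → ℂ) × ℝ => a.1 0 := by fun_prop
  have ht : Continuous fun a : (Fin (n + 1) → ℂ) × ℝ =>
      ((a.2, Fin.tail a.1) : ℝ × (Fin n → ℂ)) :=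
    continuous_snd.prodMk
      (continuous_pi fun j => (continuous_apply j.succ).comp continuous_fst)
  have h2 := (continuous_spherePoint (n := n)).comp ht
  exact h1.prodMk h2

theorem spherePoint_of_mem {θ : ℝ} {v : ComplexSphere (n + 1)} (hv0 : v.1 0 ≠ 0)
    (hphase : v.1 0 = (‖v.1 0‖ : ℂ) * Complex.exp (Complex.I * (θ : ℂ))) :
    spherePoint θ (fun j : Fin n => (v.1 0)⁻¹ * v.1 j.succ) = v := by
  set y : Fin n → ℂ := fun j => (v.1 0)⁻¹ * v.1 j.succ with hy
  have hvy : v.1 = WithLp.toLp 2 (v.1 0 • (Fin.cons 1 y : Fin (n + 1) → ℂ)) := by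
    ext i
    induction i using Fin.cases with
    | zero => simp
    | succ j => simp [hy, hv0]
  have hc : chartScale y = ‖v.1 0‖ := by
    have h1 : ‖v.1‖ = 1 := norm_eq_of_mem_sphere v
    rw [hvy, norm_toLp_smul_cons, mul_inv_eq_one₀ (chartScale_pos y).ne'] at h1
    exact h1.symm
  refine Subtype.ext ?_
  ext i
  rw [spherePoint_apply, hc, ← hphase]
  exact (congrFun (congrArg WithLp.ofLp hvy) i).symm

/-- For a matrix without eigenvectors with vanishing first entry, the eigenpairs with a given
phase are parametrized by the fibre of `eigenMap`. -/
noncomputable def fiberEquivEigenpairs {y : Columns n}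
    (hy : NoDegenerateEigenvector (ofColumns y)) (θ : ℝ) :
    (eigenMap ⁻¹' {y} : Set (Columns n)) ≃ eigenpairs (ofColumns y) θ :=
  Equiv.ofBijective (fun x => ⟨chartEigenpair x.1.1 θ, by
    have hx := ((eigenMap_eq_iff x.1 y).1 x.2).2
    refine ⟨?_, ?_⟩
    · change ofColumns y *ᵥ (_ • chartVec x.1.1) = x.1.1 0 • (_ • chartVec x.1.1)
      rw [mulVec_smul, hx, smul_comm]
    · change (spherePoint θ (Fin.tail x.1.1)).1 0 = _
      simp only [chartEigenpair]
      rw [norm_spherePoint_zero, spherePoint_zero]⟩) (by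
    constructor
    · rintro ⟨x, hx⟩ ⟨x', hx'⟩ h
      have h1 : chartEigenpair x.1 θ = chartEigenpair x'.1 θ := congrArg Subtype.val h
      have h0 : x.1 0 = x'.1 0 := congrArg Prod.fst h1
      have hs : spherePoint θ (Fin.tail x.1) = spherePoint θ (Fin.tail x'.1) :=
        congrArg Prod.snd h1
      have hc : chartScale (Fin.tail x.1) = chartScale (Fin.tail x'.1) := by
        rw [← norm_spherePoint_zero θ, hs, norm_spherePoint_zero]
      have hne : (chartScale (Fin.tail x'.1) : ℂ) * Complex.exp (Complex.I * (θ : ℂ)) ≠ 0 :=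
        mul_ne_zero (Complex.ofReal_ne_zero.2 (chartScale_pos _).ne') (Complex.exp_ne_zero _)
      have hj (j : Fin n) : x.1 j.succ = x'.1 j.succ := by
        have h2 : (spherePoint θ (Fin.tail x.1)).1 j.succ =
            (spherePoint θ (Fin.tail x'.1)).1 j.succ := by rw [hs]
        rw [spherePoint_apply, spherePoint_apply, hc] at h2
        exact mul_left_cancel₀ hne h2
      refine Subtype.ext (Prod.ext (funext fun i => Fin.cases h0 hj i) ?_)
      exact ((eigenMap_eq_iff x y).1 hx).1.trans ((eigenMap_eq_iff x' y).1 hx').1.symm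
    · rintro ⟨⟨z, v⟩, hev, hphase⟩
      have hv0 : v.1 0 ≠ 0 := by
        intro h0
        have hz := hy z v.1.ofLp hev h0
        have h1 : ‖v.1‖ = 1 := norm_eq_of_mem_sphere v
        have h2 : v.1 = 0 := by
          ext i
          exact congrFun hz i
        rw [h2, norm_zero] at h1
        exact zero_ne_one h1
      refine ⟨⟨_, eigenMap_of_mulVec_eq hev hv0⟩, Subtype.ext (Prod.ext rfl ?_)⟩
      exact spherePoint_of_mem hv0 hphase)

instance isProbabilityMeasure_uniformPhase : IsProbabilityMeasure uniformPhase := by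
  constructor
  rw [uniformPhase, Measure.smul_apply, Measure.restrict_apply MeasurableSet.univ, Set.univ_inter,
    Real.volume_Ico, sub_zero, smul_eq_mul, ENNReal.inv_mul_cancel
    (by simpa using Real.pi_pos) ENNReal.ofReal_ne_top]

/-- The contribution of one eigenvalue to the phase-averaged joint empirical measure. -/
noncomputable def chartMeasure (q : Fin (n + 1) → ℂ) : Measure (ℂ × ComplexSphere (n + 1)) :=
  uniformPhase.map (chartEigenpair q)

theorem measurable_chartEigenpair (q : Fin (n + 1) → ℂ) : Measurable (chartEigenpair q) :=
  (continuous_chartEigenpair.comp (Continuous.prodMk_right q)).measurable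

theorem chartMeasure_apply (q : Fin (n + 1) → ℂ) {s : Set (ℂ × ComplexSphere (n + 1))}
    (hs : MeasurableSet s) :
    chartMeasure q s = ∫⁻ θ, s.indicator 1 (chartEigenpair q θ) ∂uniformPhase := by
  rw [← lintegral_indicator_one hs, chartMeasure, lintegral_map (measurable_one.indicator hs)
    (measurable_chartEigenpair q)]

theorem measurable_chartMeasure : Measurable (chartMeasure (n := n)) := by
  refine Measure.measurable_of_measurable_coe _ fun s hs => ?_
  simp_rw [chartMeasure_apply _ hs]
  exact Measurable.lintegral_prod_right'
    (f := fun a : (Fin (n + 1) → ℂ) × ℝ => s.indicator 1 (chartEigenpair a.1 a.2))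
    ((measurable_one.indicator hs).comp continuous_chartEigenpair.measurable)

theorem jointEmpirical_eq_sum {y : Columns n} (hy : NoDegenerateEigenvector (ofColumns y))
    (hc : Countable (eigenMap ⁻¹' {y} : Set (Columns n))) :
    jointEmpirical (ofColumns y) =
      Measure.sum fun x : (eigenMap ⁻¹' {y} : Set (Columns n)) => chartMeasure x.1.1 := by
  have h1 (θ : ℝ) : empiricalAtPhase (ofColumns y) θ =
      Measure.sum fun x : (eigenMap ⁻¹' {y} : Set (Columns n)) =>
        Measure.dirac (chartEigenpair x.1.1 θ) := by
    ext s hs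
    rw [empiricalAtPhase, Measure.sum_apply _ hs, Measure.sum_apply _ hs,
      ← (fiberEquivEigenpairs hy θ).tsum_eq]
    rfl
  have h2 (s) (hs : MeasurableSet s) (θ : ℝ) : empiricalAtPhase (ofColumns y) θ s =
      ∑' x : (eigenMap ⁻¹' {y} : Set (Columns n)), s.indicator 1 (chartEigenpair x.1.1 θ) := by
    rw [h1, Measure.sum_apply _ hs]
    exact tsum_congr fun x => Measure.dirac_apply' _ hs
  have hmeas (s) (hs : MeasurableSet s) (x : (eigenMap ⁻¹' {y} : Set (Columns n))) :
      Measurable fun θ => s.indicator (1 : ℂ × ComplexSphere (n + 1) → ENNReal)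
        (chartEigenpair x.1.1 θ) :=
    (measurable_one.indicator hs).comp (measurable_chartEigenpair _)
  have hm : Measurable fun θ => empiricalAtPhase (ofColumns y) θ := by
    refine Measure.measurable_of_measurable_coe _ fun s hs => ?_
    simp_rw [h2 s hs]
    exact Measurable.tsum (hmeas s hs)
  ext s hs
  rw [jointEmpirical, Measure.bind_apply hs hm.aemeasurable, Measure.sum_apply _ hs]
  simp_rw [h2 s hs, chartMeasure_apply _ hs]
  exact lintegral_tsum fun x => (hmeas s hs x).aemeasurable

/-- The joint empirical measure agrees almost everywhere with a measurable measure-valued function,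
which is integrated over matrices by means of the area formula. -/
theorem exists_measurable_jointEmpirical :
    ∃ κ : Columns n → Measure (ℂ × ComplexSphere (n + 1)), Measurable κ ∧
      (∀ᵐ y, jointEmpirical (ofColumns y) = κ y) ∧
      ∀ s, MeasurableSet s → ∀ w : Columns n → ENNReal, Measurable w →
        ∫⁻ y, w y * κ y s = ∫⁻ x, ENNReal.ofReal (‖(chartJacobian x).det‖ ^ 2) *
          (w (eigenMap x) * chartMeasure x.1 s) := by
  obtain ⟨κ, hκ, hae, hint⟩ := exists_measurable_fiber_sum (volume : Measure (Columns n))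
    (f := eigenMap) (f' := eigenMapRealDeriv)
    (fun x => (hasStrictFDerivAt_eigenMap x).restrictScalars ℝ) continuous_eigenMapRealDeriv
    (measurable_chartMeasure.comp measurable_fst)
  refine ⟨κ, hκ, ?_, fun s hs w hw => ?_⟩
  · filter_upwards [hae, ae_noDegenerateEigenvector] with y hy hnd
    rw [hy.1, jointEmpirical_eq_sum hnd hy.2]
    rfl
  · rw [hint s hs w hw]
    refine lintegral_congr fun x => ?_
    rw [det_eigenMapRealDeriv, abs_of_nonneg (by positivity)]
    rfl

end Eigenpairs

/-! ### The joint density -/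

section JointDensity

variable {n : ℕ}

theorem star_dotProduct_conjTranspose_mul_mulVec {m : Type*} [Fintype m] (M : Matrix m m ℂ)
    (v : m → ℂ) :
    star v ⬝ᵥ ((Mᴴ * M) *ᵥ v) = ((∑ i, ‖(M *ᵥ v) i‖ ^ 2 : ℝ) : ℂ) := by
  rw [← mulVec_mulVec, dotProduct_mulVec, ← star_mulVec, dotProduct, Complex.ofReal_sum]
  refine Finset.sum_congr rfl fun i _ => ?_
  rw [Pi.star_apply, Complex.ofReal_pow, ← Complex.conj_mul']
  rfl

section SingularValues

variable {A V U : Matrix (Fin (n + 1)) (Fin (n + 1)) ℂ} {z : ℂ} {v : Fin (n + 1) → ℂ}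
  {d : Fin n → ℂ}

/-- The factor `R` of the determinant cancels the singularity of the integrand at `0`. -/
theorem jpdIntegrand_eq (hV : Vᴴ * V = 1) (hU : Uᴴ * U = 1) (hV0 : ∀ i, V i 0 = v i)
    (hU0 : ∀ i, U i 0 = v i)
    (hd : (Uᴴ * shifted A z * V).submatrix Fin.succ Fin.succ = diagonal d) {R : ℝ} (hR : 0 < R) :
    jpdIntegrand A z v R = ((Real.exp (-R) * ∏ i, (R + ‖d i‖ ^ 2) : ℝ) : ℂ) := by
  rw [jpdIntegrand, det_smul_one_add_tMatrix hV hU hV0 hU0 hd, ← Complex.ofReal_mul]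
  congr 1
  field_simp

theorem jpdFormula_eq (hV : Vᴴ * V = 1) (hU : Uᴴ * U = 1) (hV0 : ∀ i, V i 0 = v i)
    (hU0 : ∀ i, U i 0 = v i)
    (hd : (Uᴴ * shifted A z * V).submatrix Fin.succ Fin.succ = diagonal d) :
    jpdFormula A z v = (((Real.pi * n.factorial)⁻¹ *
      (Real.exp (-∑ i, ‖(shifted A z *ᵥ v) i‖ ^ 2) *
        ∫ R in Set.Ioi (0 : ℝ), Real.exp (-R) * ∏ i, (R + ‖d i‖ ^ 2)) : ℝ) : ℂ) := by
  rw [jpdFormula, star_dotProduct_conjTranspose_mul_mulVec,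
    setIntegral_congr_fun measurableSet_Ioi fun R hR => jpdIntegrand_eq hV hU hV0 hU0 hd hR,
    integral_complex_ofReal, Nat.cast_succ, Real.Gamma_nat_eq_factorial, one_div,
    ← Complex.ofReal_neg, ← Complex.ofReal_exp, ← Complex.ofReal_mul, ← Complex.ofReal_mul,
    mul_assoc]

end SingularValues

variable (A : Matrix (Fin (n + 1)) (Fin (n + 1)) ℂ)

theorem integrableOn_jpdIntegrand (z : ℂ) (v : ComplexSphere (n + 1)) :
    IntegrableOn (jpdIntegrand A z v.1.ofLp) (Set.Ioi 0) := by
  obtain ⟨V, U, d, hV, hU, hV0, hU0, hd⟩ :=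
    exists_unitary_compression_diagonal (shifted A z) v.1 (norm_eq_of_mem_sphere v)
  refine IntegrableOn.congr_fun (integrableOn_exp_neg_mul_prod fun i => ‖d i‖ ^ 2).ofReal
    (fun R hR => ?_) measurableSet_Ioi
  exact (jpdIntegrand_eq hV hU hV0 hU0 hd hR).symm

/-- The joint density of an eigenvalue and its eigenvector, as a real number. -/
noncomputable def jpdDensity (x : ℂ × ComplexSphere (n + 1)) : ℝ :=
  (jpdFormula A x.1 x.2.1.ofLp).re

theorem jpdDensity_nonneg_and_ofReal_eq (z : ℂ) (v : ComplexSphere (n + 1)) :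
    0 ≤ jpdDensity A (z, v) ∧ (jpdDensity A (z, v) : ℂ) = jpdFormula A z v.1.ofLp := by
  obtain ⟨V, U, d, hV, hU, hV0, hU0, hd⟩ :=
    exists_unitary_compression_diagonal (shifted A z) v.1 (norm_eq_of_mem_sphere v)
  have h := jpdFormula_eq hV hU hV0 hU0 hd
  rw [jpdDensity, h, Complex.ofReal_re]
  refine ⟨mul_nonneg (by positivity) (mul_nonneg (Real.exp_nonneg _) ?_), rfl⟩
  refine setIntegral_nonneg measurableSet_Ioi fun R hR => ?_
  have hR' : 0 < R := hR
  positivity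

theorem measurable_jpdDensity : Measurable (jpdDensity A) := by
  have hv : Continuous fun x : (ℂ × ComplexSphere (n + 1)) × ℝ => x.1.2.1.ofLp :=
    (PiLp.continuous_ofLp 2 _).comp
      (continuous_subtype_val.comp (continuous_snd.comp continuous_fst))
  have hs : Continuous fun x : (ℂ × ComplexSphere (n + 1)) × ℝ => shifted A x.1.1 := by
    unfold shifted
    fun_prop
  have hP : Continuous fun x : (ℂ × ComplexSphere (n + 1)) × ℝ => proj x.1.2.1.ofLp :=
    continuous_const.sub (hv.matrix_vecMulVec hv.star)
  have hT : Continuous fun x : (ℂ × ComplexSphere (n + 1)) × ℝ =>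
      ((x.2 : ℂ) • (1 : Matrix (Fin (n + 1)) (Fin (n + 1)) ℂ) +
        tMatrix A x.1.1 x.1.2.1.ofLp).det :=
    Continuous.matrix_det (((Complex.continuous_ofReal.comp continuous_snd).smul
      continuous_const).add (((hs.matrix_conjTranspose.matrix_mul hP).matrix_mul hs).matrix_mul hP))
  have hI : Measurable fun x : (ℂ × ComplexSphere (n + 1)) × ℝ =>
      jpdIntegrand A x.1.1 x.1.2.1.ofLp x.2 := by
    unfold jpdIntegrand
    exact Measurable.mul (by fun_prop) hT.measurable
  have hE : Continuous fun x : ℂ × ComplexSphere (n + 1) =>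
      star x.2.1.ofLp ⬝ᵥ (((shifted A x.1)ᴴ * shifted A x.1) *ᵥ x.2.1.ofLp) := by
    have hv' := hv.comp (Continuous.prodMk_left (0 : ℝ))
    have hs' := hs.comp (Continuous.prodMk_left (0 : ℝ))
    exact hv'.star.dotProduct ((hs'.matrix_conjTranspose.matrix_mul hs').matrix_mulVec hv')
  refine Complex.measurable_re.comp (Measurable.mul (Measurable.mul measurable_const
    (Complex.measurable_exp.comp hE.measurable.neg)) ?_)
  exact (hI.stronglyMeasurable.integral_prod_right').measurable

/-- The density of the law of `G_A`, with respect to Lebesgue measure on the columns. -/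
noncomputable def columnsDensity (y : Columns n) : ENNReal :=
  ENNReal.ofReal (∏ i, ∏ j, gaussDensity (ofColumns y i j - A i j))

theorem measurable_columnsDensity : Measurable (columnsDensity A) := by
  refine (continuous_finsetProd _ fun i _ => continuous_finsetProd _ fun j _ =>
    continuous_gaussDensity.comp (Continuous.sub ?_ continuous_const)).measurable.ennreal_ofReal
  exact continuous_ofColumns.matrix_elem i j

/-- In the eigenvector chart, the free columns of the matrix integrate to the joint density. The
left-hand side does not involve the phase `θ`. -/
theorem lintegral_columnsDensity_eigenMap (q : Fin (n + 1) → ℂ) (θ : ℝ) :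
    ∫⁻ B : Fin (n + 1) → Fin n → ℂ,
        ENNReal.ofReal (‖(chartJacobian (q, B)).det‖ ^ 2) * columnsDensity A (eigenMap (q, B)) =
      ENNReal.ofReal (chartScale (Fin.tail q) ^ (2 * (n + 1))) *
        (ENNReal.ofReal ((Real.pi ^ (n + 1))⁻¹ * (n.factorial * Real.pi)) *
          ENNReal.ofReal (jpdDensity A (chartEigenpair q θ))) := by
  set v : ComplexSphere (n + 1) := spherePoint θ (Fin.tail q) with hv
  obtain ⟨V, U, d, hV, hU, hV0, hU0, hd⟩ :=
    exists_unitary_compression_diagonal (shifted A (q 0)) v.1 (norm_eq_of_mem_sphere v)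
  have hv0 : v.1 0 ≠ 0 := by
    rw [← norm_ne_zero_iff, hv, norm_spherePoint_zero]
    exact (chartScale_pos _).ne'
  have hvp (i : Fin (n + 1)) : v.1.ofLp i = v.1.ofLp 0 * chartVec q i := by
    rw [hv, spherePoint_apply, spherePoint_zero]
    rfl
  have hp : jpdDensity A (chartEigenpair q θ) = (Real.pi * n.factorial)⁻¹ *
      (Real.exp (-∑ i, ‖(shifted A (q 0) *ᵥ v.1.ofLp) i‖ ^ 2) *
        ∫ R in Set.Ioi (0 : ℝ), Real.exp (-R) * ∏ i, (R + ‖d i‖ ^ 2)) := by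
    rw [jpdDensity, chartEigenpair, ← hv, jpdFormula_eq hV hU hV0 hU0 hd, Complex.ofReal_re]
  have hscale := (chartScale_pos (Fin.tail q)).le
  refine (lintegral_gaussDensity_mul_chartJacobian hV hU hV0 hU0 hd hv0 hvp).trans ?_
  rw [← ENNReal.ofReal_mul (by positivity), ← ENNReal.ofReal_mul (by positivity), hp, hv,
    norm_spherePoint_zero]
  congr 1
  have h1 : (n.factorial : ℝ) ≠ 0 := by positivity
  rw [inv_pow]
  field_simp

instance sFinite_haarSphere (N : ℕ) : SFinite (haarSphere N) := by
  rw [haarSphere]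
  infer_instance

/-- The expectation of the joint empirical measure: the area formula reduces it to an integral over
the eigenvector chart, which is an integral over the sphere. -/
theorem lintegral_columnsDensity_mul {κ : Columns n → Measure (ℂ × ComplexSphere (n + 1))}
    (hκ : ∀ s, MeasurableSet s → ∀ w : Columns n → ENNReal, Measurable w →
      ∫⁻ y, w y * κ y s = ∫⁻ x, ENNReal.ofReal (‖(chartJacobian x).det‖ ^ 2) *
        (w (eigenMap x) * chartMeasure x.1 s))
    {s : Set (ℂ × ComplexSphere (n + 1))} (hs : MeasurableSet s) :
    ∫⁻ y, columnsDensity A y * κ y s =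
      ((volume : Measure ℂ).prod (haarSphere (n + 1))).withDensity
        (fun x => ENNReal.ofReal (jpdDensity A x)) s := by
  set g : ℂ × ComplexSphere (n + 1) → ENNReal :=
    s.indicator fun x => ENNReal.ofReal (jpdDensity A x) with hg
  have hgm : Measurable g := (measurable_jpdDensity A).ennreal_ofReal.indicator hs
  set C : ENNReal := ENNReal.ofReal ((Real.pi ^ (n + 1))⁻¹ * (n.factorial * Real.pi)) with hC
  have hJm : Measurable fun x : Columns n => ENNReal.ofReal (‖(chartJacobian x).det‖ ^ 2) *
      columnsDensity A (eigenMap x) :=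
    ((continuous_chartJacobian.matrix_det.norm.pow 2).measurable.ennreal_ofReal).mul
      ((measurable_columnsDensity A).comp continuous_eigenMap.measurable)
  have hκm : Measurable fun q : Fin (n + 1) → ℂ => chartMeasure q s :=
    (Measure.measurable_coe hs).comp measurable_chartMeasure
  have hchart (q : Fin (n + 1) → ℂ) :
      ∫⁻ B : Fin (n + 1) → Fin n → ℂ, ENNReal.ofReal (‖(chartJacobian (q, B)).det‖ ^ 2) *
          (columnsDensity A (eigenMap (q, B)) * chartMeasure q s) =
        ENNReal.ofReal (chartScale (Fin.tail q) ^ (2 * (n + 1))) *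
          ∫⁻ θ, C * g (chartEigenpair q θ) ∂uniformPhase := by
    have h1 : Measurable fun B : Fin (n + 1) → Fin n → ℂ =>
        ENNReal.ofReal (‖(chartJacobian (q, B)).det‖ ^ 2) * columnsDensity A (eigenMap (q, B)) :=
      hJm.comp measurable_prodMk_left
    have h2 : Measurable fun θ =>
        s.indicator (1 : ℂ × ComplexSphere (n + 1) → ENNReal) (chartEigenpair q θ) :=
      (measurable_one.indicator hs).comp (measurable_chartEigenpair q)
    have h3 : Measurable fun θ => C * g (chartEigenpair q θ) :=
      (hgm.comp (measurable_chartEigenpair q)).const_mul C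
    simp_rw [← mul_assoc]
    rw [lintegral_mul_const _ h1, chartMeasure_apply q hs, ← lintegral_const_mul _ h2,
      ← lintegral_const_mul _ h3]
    refine lintegral_congr fun θ => ?_
    rw [lintegral_columnsDensity_eigenMap A q θ]
    by_cases h : chartEigenpair q θ ∈ s
    · rw [hg, Set.indicator_of_mem h, Set.indicator_of_mem h, Pi.one_apply, mul_one]
    · rw [hg, Set.indicator_of_notMem h, Set.indicator_of_notMem h, mul_zero, mul_zero, mul_zero]
  have hmeas : Measurable fun q : Fin (n + 1) → ℂ =>
      ENNReal.ofReal (chartScale (Fin.tail q) ^ (2 * (n + 1))) *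
        ∫⁻ θ, C * g (chartEigenpair q θ) ∂uniformPhase := by
    simp_rw [← hchart]
    exact Measurable.lintegral_prod_right' (f := fun x : Columns n =>
      ENNReal.ofReal (‖(chartJacobian x).det‖ ^ 2) *
        (columnsDensity A (eigenMap x) * chartMeasure x.1 s))
      (by
        simp_rw [← mul_assoc]
        exact hJm.mul (hκm.comp measurable_fst))
  have hsphere (t : ℂ) : ∫⁻ y : Fin n → ℂ, ENNReal.ofReal (chartScale y ^ (2 * (n + 1))) *
      ∫⁻ θ, C * g (t, spherePoint θ y) ∂uniformPhase =
        ∫⁻ v, g (t, v) ∂haarSphere (n + 1) := by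
    have hgt : Measurable fun v => g (t, v) := hgm.comp measurable_prodMk_left
    have h := lintegral_haarSphere (hgt.const_mul C)
    have ha : ENNReal.ofReal (Real.pi ^ (n + 1)) * C =
        ENNReal.ofReal (n.factorial * Real.pi) := by
      rw [hC, ← ENNReal.ofReal_mul (by positivity), mul_inv_cancel_left₀ (by positivity)]
    rw [lintegral_const_mul C hgt, ← mul_assoc, ha] at h
    refine (ENNReal.mul_right_inj ?_ ENNReal.ofReal_ne_top).1 h.symm
    exact (ENNReal.ofReal_pos.2 (by positivity)).ne'
  rw [hκ s hs _ (measurable_columnsDensity A), Measure.volume_eq_prod, lintegral_prod]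
  · simp_rw [hchart]
    rw [lintegral_pi_fin_succ hmeas, withDensity_apply _ hs, ← lintegral_indicator hs, ← hg,
      lintegral_prod _ hgm.aemeasurable]
    exact lintegral_congr fun t => hsphere t
  · simp_rw [← mul_assoc]
    exact (hJm.mul (hκm.comp measurable_fst)).aemeasurable

theorem measurableEmbedding_ofColumns :
    MeasurableEmbedding (ofColumns : Columns n → Matrix (Fin (n + 1)) (Fin (n + 1)) ℂ) := by
  rw [← columnsEquiv_symm]
  exact (columnsEquiv n).symm.measurableEmbedding

theorem aemeasurable_jointEmpirical :
    AEMeasurable (jointEmpirical (N := n + 1)) (deformedGinibreLaw A) := by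
  obtain ⟨κ, hκ, hae, -⟩ := exists_measurable_jointEmpirical (n := n)
  rw [deformedGinibreLaw_eq_map, measurableEmbedding_ofColumns.aemeasurable_map_iff]
  exact ⟨κ, hκ, (withDensity_absolutelyContinuous _ _).ae_le hae⟩

theorem meanJointEmpirical_eq_withDensity :
    meanJointEmpirical (deformedGinibreLaw A) =
      ((volume : Measure ℂ).prod (haarSphere (n + 1))).withDensity
        (fun x => ENNReal.ofReal (jpdDensity A x)) := by
  obtain ⟨κ, hκm, hae, hκ⟩ := exists_measurable_jointEmpirical (n := n)
  ext s hs
  rw [← lintegral_columnsDensity_mul A hκ hs, meanJointEmpirical,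
    Measure.bind_apply hs (aemeasurable_jointEmpirical A), deformedGinibreLaw_eq_map,
    measurableEmbedding_ofColumns.lintegral_map]
  have h : ∀ᵐ y : Columns n ∂(volume : Measure (Columns n)).withDensity (columnsDensity A),
      jointEmpirical (ofColumns y) s = κ y s := by
    filter_upwards [(withDensity_absolutelyContinuous _ _).ae_le hae] with y hy
    rw [hy]
  refine (lintegral_congr_ae h).trans ?_
  exact lintegral_withDensity_eq_lintegral_mul _ (measurable_columnsDensity A)
    ((Measure.measurable_coe hs).comp hκm)

end JointDensity

end GinibreJPD

theorem mainTheorem3 (N : ℕ) [NeZero N] (A : Matrix (Fin N) (Fin N) ℂ) :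
    AEMeasurable (GinibreJPD.jointEmpirical (N := N)) (GinibreJPD.deformedGinibreLaw A) ∧
    (∀ (z : ℂ) (v : GinibreJPD.ComplexSphere N),
      IntegrableOn (GinibreJPD.jpdIntegrand A z v.1.ofLp) (Set.Ioi 0)) ∧
    ∃ p : ℂ × GinibreJPD.ComplexSphere N → ℝ,
      Measurable p ∧
      (∀ (z : ℂ) (v : GinibreJPD.ComplexSphere N),
        0 ≤ p (z, v) ∧ (p (z, v) : ℂ) = GinibreJPD.jpdFormula A z v.1.ofLp) ∧
      GinibreJPD.meanJointEmpirical (GinibreJPD.deformedGinibreLaw A) =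
        ((volume : Measure ℂ).prod (GinibreJPD.haarSphere N)).withDensity
          (fun x => ENNReal.ofReal (p x)) ∧
      GinibreJPD.jointLaw (GinibreJPD.deformedGinibreLaw A) =
        ((volume : Measure ℂ).prod (GinibreJPD.haarSphere N)).withDensity
          (fun x => ENNReal.ofReal (p x / N)) := by
  obtain ⟨n, rfl⟩ := Nat.exists_eq_succ_of_ne_zero (NeZero.ne N)
  -- `NeZero` is a proposition, so that the given instance agrees with the one found for `n + 1`
  have hmean := GinibreJPD.meanJointEmpirical_eq_withDensity A
  have hp := GinibreJPD.measurable_jpdDensity A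
  refine ⟨GinibreJPD.aemeasurable_jointEmpirical A, GinibreJPD.integrableOn_jpdIntegrand A,
    GinibreJPD.jpdDensity A, hp, GinibreJPD.jpdDensity_nonneg_and_ofReal_eq A, hmean, ?_⟩
  refine (congrArg ((((n + 1 : ℕ) : ENNReal)⁻¹) • ·) hmean).trans ?_
  rw [← withDensity_smul _ hp.ennreal_ofReal]
  congr 1
  funext x
  have hn : (0 : ℝ) < ((n + 1 : ℕ) : ℝ) := by positivity
  rw [Pi.smul_apply, smul_eq_mul, ENNReal.ofReal_div_of_pos hn, ENNReal.ofReal_natCast,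
    ENNReal.div_eq_inv_mul]
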